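/- Let $\lambda$ be the fair coin-tossing measure on Cantor space $\{0,1\}^{\mathbb N}$. A Martin-Löf test is a computable sequence $(U_n)_{n\in\mathbb N}$ of open sets with $\lambda(U_n)\le 2^{-n}$; it is universal if $\bigcap_n V_n\subseteq\bigcap_n U_n$ for every Martin-Löf test $(V_n)$. Let $\mathrm{MLR}$ be the set of Martin-Löf random sequences, i.e. of the sequences that lie in $\bigcap_n V_n$ for no Martin-Löf test $(V_n)$. Let $\mathcal A_{\lambda>0}$ be the represented space of closed sets $A\subseteq\{0,1\}^{\mathbb N}$ with $\lambda(A)>0$, where $A$ is named by an enumeration of finite words $w_i$ such that the complement of $A$ is the union of the cylinders $w_i\{0,1\}^{\mathbb N}$. Let $T$ be the shift on $\{0,1\}^{\mathbb N}$, and let $\mathrm{HittingTime}_{\mathcal A}:\subseteq\mathrm{MLR}\times\mathcal A_{\lambda>0}\to\mathbb N$ be the partial function $(p,A)\mapsto\min\{n\in\mathbb N\mid T^n(p)\in A\}$, defined on the pairs $(p,A)$ for which such an $n$ exists. For a universal Martin-Löf test $\mathcal U=(U_n)$ let $\mathrm{LAY}_{\mathcal U}:\mathrm{MLR}\rightrightarrows\mathbb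 N$ be the multivalued function with $n\in\mathrm{LAY}_{\mathcal U}(p)$ iff $p\notin U_n$. A partial function $f:\subseteq\mathrm{MLR}\to\mathbf Y$ is layerwise computable with respect to $\mathcal U$ if there is a computable partial function $g:\subseteq\mathrm{MLR}\times\mathbb N\to\mathbf Y$ with $g(p,k)=f(p)$ whenever $p\in\operatorname{dom} f$ and $p\notin U_k$; a partial function $f$ on $\mathrm{MLR}\times\mathbf X$ is weakly layerwise computable with respect to $\mathcal U$ if for every computable $x\in\mathbf X$ the slice $p\mapsto f(p,x)$ is layerwise computable with respect to $\mathcal U$. Theorem. For every universal Martin-Löf test $\mathcal U$, the problem $\mathrm{HittingTime}_{\mathcal A}$ is Weihrauch equivalent to $\mathrm{LAY}_{\mathcal U}$, but $\mathrm{HittingTime}_{\mathcal A}$ is not weakly layerwise computable with respect to $\mathcal U$. -/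

import Mathlib

open MeasureTheory TopologicalSpace
open scoped ENNReal

namespace HittingTime

/-! ### Sequence spaces -/

/-- Baire space. -/
abbrev Baire : Type := ℕ → ℕ

/-- Cantor space. -/
abbrev Cantor : Type := ℕ → Bool

/-- The prefix of length `n` of an infinite sequence. -/
def pre {α : Type} (p : ℕ → α) (n : ℕ) : List α := (List.range n).map p

/-- The cylinder of all infinite binary sequences that extend the word `w`. -/
def cyl (w : List Bool) : Set Cantor := {x | pre x w.length = w}

/-- The standard pairing of Baire space with itself: `p` on the even, `q` on the odd places. -/
def pairB (p q : Baire) : Baire := fun n => if n % 2 = 0 then p (n / 2) else q (n / 2)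

/-- The shift operator on Cantor space. -/
def shift (x : Cantor) : Cantor := fun n => x (n + 1)

/-- The fair coin-tossing (Lebesgue) measure on Cantor space. -/
noncomputable def coin : Measure Cantor :=
  Measure.infinitePi fun _ : ℕ => (PMF.uniformOfFintype Bool).toMeasure

/-! ### Computable functions on Baire space -/

/-- `F` is computable on its domain: some computable word function `φ`, where `φ w` is the part of
the output that has been written once the input word `w` has been read, has the property that for
all `p` in the domain of `F` the words `φ (pre p s)` are prefixes of `F p` of unbounded length. -/
def ComputableB (F : Baire →. Baire) : Prop :=
  ∃ φ : List ℕ → List ℕ, Computable φ ∧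
    ∀ p q, q ∈ F p →
      (∀ s, ∃ t, φ (pre p s) = pre q t) ∧ (∀ t, ∃ s, t ≤ (φ (pre p s)).length)

/-! ### Represented spaces -/

/-- A represented space: `IsName` is the graph of a partial surjection from Baire space. -/
class Represented (X : Type) where
  IsName : Baire → X → Prop
  unique : ∀ {p x y}, IsName p x → IsName p y → x = y
  exists_name : ∀ x, ∃ p, IsName p x

open Represented (IsName)

theorem pairB_left (p q : Baire) : (fun n => pairB p q (2 * n)) = p := by
  funext n; simp [pairB]

theorem pairB_right (p q : Baire) : (fun n => pairB p q (2 * n + 1)) = q := by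
  funext n
  have h : (2 * n + 1) / 2 = n := by omega
  simp [pairB, h, Nat.add_mod]

/-- A natural number is named by any sequence that starts with it. -/
instance : Represented ℕ where
  IsName p n := p 0 = n
  unique h h' := h.symm.trans h'
  exists_name n := ⟨fun _ => n, rfl⟩

/-- Cantor space is regarded as a subspace of Baire space. -/
instance : Represented Cantor where
  IsName p x := p = fun n => (x n).toNat
  unique := by
    rintro p x y h h'
    funext n
    have hn : (x n).toNat = (y n).toNat := congrFun (h.symm.trans h') n
    cases hx : x n <;> cases hy : y n <;> simp [hx, hy] at hn ⊢
  exists_name x := ⟨_, rfl⟩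

instance {X Y : Type} [Represented X] [Represented Y] : Represented (X × Y) where
  IsName r z := ∃ p q, r = pairB p q ∧ IsName p z.1 ∧ IsName q z.2
  unique := by
    rintro _ ⟨x, y⟩ ⟨x', y'⟩ ⟨p, q, rfl, hx, hy⟩ ⟨p', q', h, hx', hy'⟩
    have h1 : p = p' := by rw [← pairB_left p q, h, pairB_left]
    have h2 : q = q' := by rw [← pairB_right p q, h, pairB_right]
    subst h1 h2
    exact Prod.ext (Represented.unique hx hx') (Represented.unique hy hy')
  exists_name := by
    rintro ⟨x, y⟩
    obtain ⟨p, hp⟩ := Represented.exists_name x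
    obtain ⟨q, hq⟩ := Represented.exists_name y
    exact ⟨_, p, q, rfl, hp, hq⟩

instance {X : Type} [Represented X] (P : X → Prop) : Represented {x // P x} where
  IsName p x := IsName p x.1
  unique h h' := Subtype.ext (Represented.unique h h')
  exists_name x := Represented.exists_name x.1

/-- The union of the cylinders that are listed by `p`: the entry `0` lists nothing, and
the entry `k + 1` lists the word with code `k`, if there is one. -/
def listed (p : Baire) : Set Cantor :=
  {x | ∃ (i : ℕ) (w : List Bool), p i = Encodable.encode w + 1 ∧ x ∈ cyl w}

theorem exists_listed {U : Set Cantor} (hU : IsOpen U) : ∃ p, listed p = U := by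
  classical
  refine ⟨fun i => if ∃ w : List Bool, Encodable.encode w = i ∧ cyl w ⊆ U then i + 1 else 0, ?_⟩
  ext x
  constructor
  · rintro ⟨i, w, hi, hx⟩
    dsimp only at hi
    split_ifs at hi with h
    · obtain ⟨v, hv, hvU⟩ := h
      have : v = w := Encodable.encode_injective (by omega)
      exact hvU (this ▸ hx)
  · intro hx
    obtain ⟨n, hn⟩ : ∃ n, PiNat.cylinder x n ⊆ U := by
      obtain ⟨s, ⟨y, n, rfl⟩, hxs, hs⟩ :=
        (PiNat.isTopologicalBasis_cylinders (fun _ : ℕ => Bool)).exists_subset_of_mem_open hx hU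
      exact ⟨n, by rwa [PiNat.mem_cylinder_iff_eq.mp hxs]⟩
    have hlen : (pre x n).length = n := by simp [pre]
    refine ⟨Encodable.encode (pre x n), pre x n, if_pos ⟨_, rfl, fun y hy => hn fun i hi => ?_⟩, ?_⟩
    · simp only [cyl, Set.mem_ofPred_eq, hlen]
    · have hy' : pre y n = pre x n := by simpa only [cyl, Set.mem_ofPred_eq, hlen] using hy
      exact List.map_inj_left.mp hy' i (List.mem_range.mpr hi)

/-- The hyperspace of open subsets of Cantor space. -/
instance : Represented (Opens Cantor) where
  IsName p U := listed p = (U : Set Cantor)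
  unique h h' := Opens.ext (h.symm.trans h')
  exists_name U := exists_listed U.isOpen

/-- The hyperspace of closed subsets of Cantor space: closed sets are named by the names of their
complements. -/
instance : Represented (Closeds Cantor) where
  IsName p A := IsName p A.compl
  unique {p A B} h h' := by
    have hc : A.compl = B.compl := Represented.unique h h'
    apply Closeds.ext
    have hs : (A : Set Cantor)ᶜ = (B : Set Cantor)ᶜ := congrArg (fun U : Opens Cantor => (U : Set Cantor)) hc
    exact compl_injective hs
  exists_name A := Represented.exists_name A.compl

/-- A point is computable if it has a computable name. -/
def IsComputablePoint {X : Type} [Represented X] (x : X) : Prop :=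
  ∃ p : Baire, Computable p ∧ IsName p x

/-! ### Problems and Weihrauch reducibility -/

/-- A partial multivalued function from `X` to `Y`; its domain is `{x | (f x).Nonempty}`. -/
abbrev Problem (X Y : Type) : Type := X → Set Y

variable {X Y Z W : Type} [Represented X] [Represented Y] [Represented Z] [Represented W]

/-- `F` is a realizer of `f`: every name of a point `x` of the domain of `f` is mapped to a name
of an element of `f x`. -/
def Realizes (F : Baire →. Baire) (f : Problem X Y) : Prop :=
  ∀ p x, IsName p x → (f x).Nonempty → ∃ q ∈ F p, ∃ y ∈ f x, IsName q y

/-- A partial function between represented spaces is computable if it has a computable realizer. -/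
def ComputableMap (g : X →. Y) : Prop :=
  ∃ F, ComputableB F ∧ Realizes F (fun x => {y | y ∈ g x})

/-- Weihrauch reducibility: there are computable `K` and `H` such that `p ↦ K ⟨p, G (H p)⟩`
realizes `f` whenever `G` realizes `g`. -/
def WeihrauchLE (f : Problem X Y) (g : Problem Z W) : Prop :=
  ∃ K H : Baire →. Baire, ComputableB K ∧ ComputableB H ∧
    ∀ G : Baire →. Baire, Realizes G g →
      Realizes (fun p => (H p).bind fun a => (G a).bind fun b => K (pairB p b)) f

/-- Weihrauch equivalence. -/
def WeihrauchEquiv (f : Problem X Y) (g : Problem Z W) : Prop :=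
  WeihrauchLE f g ∧ WeihrauchLE g f

/-! ### Randomness -/

/-- A Martin-Löf test: a computable sequence of open sets `U i` of measure at most `2 ^ (-i)`. -/
def IsMLTest (U : ℕ → Opens Cantor) : Prop :=
  (∃ e : ℕ → ℕ → ℕ, Computable₂ e ∧ ∀ i, IsName (e i) (U i)) ∧
    ∀ i, coin (U i) ≤ (2 : ℝ≥0∞)⁻¹ ^ i

/-- A universal Martin-Löf test. -/
def IsUniversalMLTest (U : ℕ → Opens Cantor) : Prop :=
  IsMLTest U ∧
    ∀ V : ℕ → Opens Cantor, IsMLTest V → (⋂ i, (V i : Set Cantor)) ⊆ ⋂ i, (U i : Set Cantor)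

/-- `x` is Martin-Löf random: it passes every Martin-Löf test. -/
def IsMLRandom (x : Cantor) : Prop :=
  ∀ V : ℕ → Opens Cantor, IsMLTest V → x ∉ ⋂ i, (V i : Set Cantor)

/-- The random sequences are those that pass one given universal test. -/
theorem isMLRandom_iff {U : ℕ → Opens Cantor} (hU : IsUniversalMLTest U) (x : Cantor) :
    IsMLRandom x ↔ x ∉ ⋂ i, (U i : Set Cantor) :=
  ⟨fun h => h U hU.1, fun h V hV hx => h (hU.2 V hV hx)⟩

/-- The represented space of Martin-Löf random sequences. -/
abbrev MLR : Type := {x : Cantor // IsMLRandom x}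

/-- The problem LAY: given a random sequence, find a layer of the test `U` that contains it. -/
def lay (U : ℕ → Opens Cantor) : Problem MLR ℕ := fun p => {n | p.1 ∉ U n}

/-- `f` is layerwise computable with respect to the test `U`: there is a computable partial
function `g` such that `g (p, k)` is a value of `f` at `p` whenever `p ∉ U k`. -/
def LayerwiseComputable (U : ℕ → Opens Cantor) (f : Problem MLR Y) : Prop :=
  ∃ g : MLR × ℕ →. Y, ComputableMap g ∧
    ∀ (p : MLR) (k : ℕ), p.1 ∉ U k → (f p).Nonempty → ∃ y ∈ f p, y ∈ g (p, k)

/-- `f` is weakly layerwise computable with respect to the test `U`: for every computable `x` the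
slice `p ↦ f (p, x)` is layerwise computable. -/
def WeaklyLayerwiseComputable (U : ℕ → Opens Cantor) (f : Problem (MLR × X) Y) : Prop :=
  ∀ x : X, IsComputablePoint x → LayerwiseComputable U (fun p => f (p, x))

/-! ### Hitting time -/

/-- The closed subsets of Cantor space of positive measure. -/
abbrev PosClosed : Type := {A : Closeds Cantor // 0 < coin A}

/-- The hitting time: the least `n` such that the `n`-th shift of `p` lies in `A`. The domain
consists of the pairs `(p, A)` for which there is such an `n`. -/
def hittingTimeClosed : Problem (MLR × PosClosed) ℕ := fun z =>
  {n | IsLeast {m : ℕ | shift^[m] z.1.1 ∈ z.2.1} n}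

end HittingTime

namespace HittingTime

open Represented (IsName)

/-! ### Words and sequences -/

/-! Both reductions rest on one mind-change process, `guess`: keep the least candidate that has not
yet been refuted. If some candidate is never refuted, all but finitely many guesses are correct
(`exists_guess_eventually`), and each wrong guess is recognized at some finite stage.

LAY reduces to the hitting time as follows. From a random `y`, guess a layer that does not contain
`y`. Whenever the guess of stage `m` turns out wrong, remove from the closed set a cylinder of
length `m + 1` around the `m`-th shift of `y`. Only finitely many cylinders are removed, and a
diagonal word avoids them all (`exists_cyl_disjoint_avoidName`). So the set has positive measure and
the random `y` reaches it. If it is reached at time `n`, the `n`-th cylinder was not removed, hence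
the guess of stage `n` was correct.

Conversely, given `y` and a closed set, guess the hitting time. Write a new sequence that copies
`y`, but each time the guess of stage `k` is refuted, first extend what has been written into `U k`,
then copy `y` from the start. Such an extension exists because a word followed by zeros is not
random and so lies in every layer (`exists_computable_extension`). There are finitely many
refutations, so the result is a finite word followed by `y`, which is random. If it lies outside `U
k`, the guess of stage `k` was never refuted, and it is the exact hitting time.

For the negative part, let `K` be the complement of `U 3`; all its points are random. There is a
computably enumerable open set `dense` inside the cylinder of `0` that is dense relative to `K` in
that cylinder (`exists_mem_dense_near`) without covering `K` there (`exists_notMem_dense`). Let `A`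
be its complement. At a point of `K` in the cylinder of `0` and outside `dense` the hitting time of
`A` is 0, yet points of `K` arbitrarily close to it lie in `dense` and have positive hitting time. A
layerwise algorithm would be continuous on `K`, which is impossible. -/

theorem length_pre {α : Type} (p : ℕ → α) (n : ℕ) : (pre p n).length = n := by simp [pre]

theorem getElem_pre {α : Type} (p : ℕ → α) {n i : ℕ} (h : i < (pre p n).length) :
    (pre p n)[i] = p i := by simp [pre]

theorem pre_eq_iff {α : Type} {p q : ℕ → α} {n : ℕ} :
    pre p n = pre q n ↔ ∀ i < n, p i = q i := by
  simp only [pre, List.map_inj_left, List.mem_range]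

theorem pre_succ {α : Type} (p : ℕ → α) (n : ℕ) : pre p (n + 1) = pre p n ++ [p n] := by
  simp [pre, List.range_succ]

theorem eq_pre_iff {α : Type} {w : List α} {p : ℕ → α} {n : ℕ} :
    w = pre p n ↔ w.length = n ∧ ∀ i (h : i < w.length), w[i] = p i := by
  constructor
  · rintro rfl
    exact ⟨length_pre p n, fun i h => getElem_pre p h⟩
  · rintro ⟨h, h'⟩
    refine List.ext_getElem (by rw [h, length_pre]) fun i h1 h2 => ?_
    rw [h' i h1, getElem_pre]

/-- The sequence `w` followed by `x`. -/
def cat {α : Type} (w : List α) (x : ℕ → α) : ℕ → α := fun n => w.getD n (x (n - w.length))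

theorem cat_of_lt {α : Type} (w : List α) (x : ℕ → α) {n : ℕ} (h : n < w.length) :
    cat w x n = w[n] := by simp [cat, h]

theorem cat_add {α : Type} (w : List α) (x : ℕ → α) (n : ℕ) :
    cat w x (w.length + n) = x n := by simp [cat]

theorem cat_of_ge {α : Type} (w : List α) (x : ℕ → α) {n : ℕ} (h : w.length ≤ n) :
    cat w x n = x (n - w.length) := by
  obtain ⟨k, rfl⟩ := Nat.exists_eq_add_of_le h
  simp [cat_add]

theorem cat_congr {α : Type} (w : List α) {x y : ℕ → α} {n : ℕ}
    (h : ∀ i < n, x i = y i) : ∀ i < w.length + n, cat w x i = cat w y i := by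
  intro i hi
  by_cases hw : i < w.length
  · rw [cat_of_lt _ _ hw, cat_of_lt _ _ hw]
  · rw [cat_of_ge _ _ (by omega), cat_of_ge _ _ (by omega)]
    exact h _ (by omega)

theorem cat_nil {α : Type} (x : ℕ → α) : cat [] x = x := by
  funext n; simp [cat]

theorem cat_append {α : Type} (v w : List α) (x : ℕ → α) : cat (v ++ w) x = cat v (cat w x) := by
  funext n
  by_cases hv : n < v.length
  · rw [cat_of_lt _ _ hv, cat_of_lt _ _ (by simp; omega), List.getElem_append_left]
  · obtain ⟨k, rfl⟩ := Nat.exists_eq_add_of_le (not_lt.mp hv)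
    rw [cat_add]
    by_cases hw : k < w.length
    · rw [cat_of_lt _ _ hw, cat_of_lt _ _ (by simp; omega), List.getElem_append_right (by omega)]
      simp
    · obtain ⟨j, rfl⟩ := Nat.exists_eq_add_of_le (not_lt.mp hw)
      rw [cat_add, ← add_assoc, ← List.length_append, cat_add]

theorem pre_cat {α : Type} (w : List α) (x : ℕ → α) (n : ℕ) :
    pre (cat w x) (w.length + n) = w ++ pre x n := by
  symm
  rw [eq_pre_iff]
  refine ⟨by simp [length_pre], fun i h => ?_⟩
  by_cases hw : i < w.length
  · rw [List.getElem_append_left hw, cat_of_lt _ _ hw]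
  · rw [List.getElem_append_right (by omega), getElem_pre, cat_of_ge _ _ (by omega)]

theorem pre_cat_length {α : Type} (w : List α) (x : ℕ → α) :
    pre (cat w x) w.length = w := by
  simpa [pre] using pre_cat w x 0

theorem mem_cyl {w : List Bool} {x : Cantor} : x ∈ cyl w ↔ pre x w.length = w := Iff.rfl

theorem mem_cyl_pre {x y : Cantor} {n : ℕ} : x ∈ cyl (pre y n) ↔ ∀ i < n, x i = y i := by
  rw [mem_cyl, length_pre, pre_eq_iff]

theorem self_mem_cyl_pre (x : Cantor) (n : ℕ) : x ∈ cyl (pre x n) :=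
  mem_cyl_pre.mpr fun _ _ => rfl

theorem cat_mem_cyl (w : List Bool) (x : Cantor) : cat w x ∈ cyl w := pre_cat_length w x

theorem mem_cyl_iff_exists {w : List Bool} {x : Cantor} : x ∈ cyl w ↔ ∃ y, x = cat w y := by
  constructor
  · intro h
    refine ⟨fun n => x (w.length + n), funext fun n => ?_⟩
    by_cases hw : n < w.length
    · rw [cat_of_lt _ _ hw]
      exact ((eq_pre_iff.mp (mem_cyl.mp h).symm).2 n hw).symm
    · rw [cat_of_ge _ _ (by omega)]
      congr 1; omega
  · rintro ⟨y, rfl⟩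
    exact cat_mem_cyl w y

theorem cat_mem_cyl_append {v w : List Bool} {x : Cantor} : cat v x ∈ cyl (v ++ w) ↔ x ∈ cyl w := by
  rw [mem_cyl, mem_cyl, List.length_append, pre_cat, List.append_cancel_left_eq]

theorem shift_iterate (x : Cantor) (m : ℕ) : shift^[m] x = fun n => x (m + n) := by
  induction m generalizing x with
  | zero => simp
  | succ m ih =>
    rw [Function.iterate_succ_apply, ih]
    funext n
    simp only [shift]
    congr 1; omega

theorem shift_iterate_cat (w : List Bool) (x : Cantor) : shift^[w.length] (cat w x) = x := by
  rw [shift_iterate]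
  funext n
  exact cat_add w x n

/-! ### Topology -/

theorem isOpen_setOf_pre (n : ℕ) (S : Set (List Bool)) :
    IsOpen {x : Cantor | pre x n ∈ S} := by
  have : Continuous fun x : Cantor => fun i : Fin n => x i := by fun_prop
  have h2 : {x : Cantor | pre x n ∈ S} =
      (fun x : Cantor => fun i : Fin n => x i) ⁻¹' {f | List.ofFn f ∈ S} := by
    ext x
    simp only [Set.mem_ofPred_eq, Set.mem_preimage]
    have : List.ofFn (fun i : Fin n => x i) = pre x n := by
      rw [eq_pre_iff]; simp
    rw [this]
  rw [h2]
  exact (isOpen_discrete _).preimage this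

theorem isOpen_cyl (w : List Bool) : IsOpen (cyl w) :=
  isOpen_setOf_pre w.length {w}

theorem isClosed_cyl (w : List Bool) : IsClosed (cyl w) :=
  ⟨isOpen_setOf_pre w.length {w}ᶜ⟩

theorem isOpen_listed (p : Baire) : IsOpen (listed p) := by
  have : listed p = ⋃ (i : ℕ) (w : List Bool) (_ : p i = Encodable.encode w + 1), cyl w := by
    ext x; simp [listed]
  rw [this]
  exact isOpen_iUnion fun _ => isOpen_iUnion fun _ => isOpen_iUnion fun _ => isOpen_cyl _

/-! ### Measure -/

instance : IsProbabilityMeasure coin := by unfold coin; infer_instance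

theorem measurable_cat (w : List Bool) : Measurable (cat w : Cantor → Cantor) := by
  refine measurable_pi_iff.mpr fun n => ?_
  by_cases hw : n < w.length
  · simp only [cat_of_lt _ _ hw]; exact measurable_const
  · simp only [cat_of_ge _ _ (not_lt.mp hw)]; exact measurable_pi_apply _

theorem fairBit_apply (s : Set Bool) : (PMF.uniformOfFintype Bool).toMeasure s =
    2⁻¹ * s.indicator 1 false + 2⁻¹ * s.indicator 1 true := by
  rw [PMF.toMeasure_apply_fintype]
  simp [Set.indicator, add_comm]

/-- The first bit is fair and independent of the rest. By uniqueness of product measures it suffices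
to compare both sides on finite boxes. -/
theorem coin_eq_sum : coin = (2 : ℝ≥0∞)⁻¹ • coin.map (cat [false]) + (2 : ℝ≥0∞)⁻¹ • coin.map (cat [true]) := by
  symm
  refine Measure.eq_infinitePi _ fun s t ht => ?_
  -- On a box, fixing the first bit turns the constraint at 0 into a condition on `b` and moves the
  -- others down by one place; the factors are identical, so their product is unchanged.
  have key : ∀ b : Bool, coin ((cat [b]) ⁻¹' (Set.pi s t)) =
      (if 0 ∈ s then (t 0).indicator 1 b else 1) *
        ∏ i ∈ s.erase 0, (PMF.uniformOfFintype Bool).toMeasure (t i) := by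
    intro b
    have h1 : (cat [b]) ⁻¹' (Set.pi s t) = {x : Cantor | 0 ∈ s → b ∈ t 0} ∩
        Set.pi (((s.erase 0).image Nat.pred : Finset ℕ) : Set ℕ) (fun i => t (i + 1)) := by
      ext x
      simp only [Set.mem_preimage, Set.mem_pi, Set.mem_inter_iff, Set.mem_ofPred_eq, Finset.coe_image,
        Set.mem_image, Finset.mem_coe, Finset.mem_erase]
      constructor
      · refine fun h => ⟨fun h0 => by simpa [cat] using h 0 h0, ?_⟩
        rintro _ ⟨i, ⟨hi0, hi⟩, rfl⟩
        obtain ⟨j, rfl⟩ := Nat.exists_eq_succ_of_ne_zero hi0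
        simpa [cat] using h _ hi
      · rintro ⟨h0, h⟩ i hi
        rcases i with _ | j
        · simpa [cat] using h0 hi
        · simpa [cat] using h j ⟨j + 1, ⟨by omega, hi⟩, rfl⟩
    have h2 : coin (Set.pi (((s.erase 0).image Nat.pred : Finset ℕ) : Set ℕ) (fun i => t (i + 1))) =
        ∏ i ∈ s.erase 0, (PMF.uniformOfFintype Bool).toMeasure (t i) := by
      rw [coin, Measure.infinitePi_pi _ (fun i _ => ht _), Finset.prod_image]
      · refine Finset.prod_congr rfl fun i hi => ?_
        have : i ≠ 0 := (Finset.mem_erase.mp hi).1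
        rw [Nat.pred_eq_sub_one, Nat.sub_add_cancel (by omega)]
      · intro i hi j hj h
        have := (Finset.mem_erase.mp hi).1
        have := (Finset.mem_erase.mp hj).1
        simp only [Nat.pred_eq_sub_one] at h
        omega
    rw [h1, ← h2]
    by_cases h0 : 0 ∈ s
    · by_cases hb : b ∈ t 0 <;> simp [h0, hb]
    · simp [h0]
  have hm : MeasurableSet (Set.pi (s : Set ℕ) t) :=
    MeasurableSet.pi s.countable_toSet fun i _ => ht i
  rw [Measure.add_apply, Measure.smul_apply, Measure.smul_apply,
    Measure.map_apply (measurable_cat _) hm, Measure.map_apply (measurable_cat _) hm, key, key]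
  by_cases h0 : 0 ∈ s
  · rw [← Finset.mul_prod_erase s _ h0, fairBit_apply]
    simp only [h0, if_true, smul_eq_mul]
    ring
  · simp only [h0, if_false, smul_eq_mul, one_mul, Finset.erase_eq_of_notMem h0]
    rw [← add_mul, ENNReal.inv_two_add_inv_two, one_mul]

theorem coin_eq {E : Set Cantor} (hE : MeasurableSet E) :
    coin E = 2⁻¹ * coin (cat [false] ⁻¹' E) + 2⁻¹ * coin (cat [true] ⁻¹' E) := by
  conv_lhs => rw [coin_eq_sum]
  rw [Measure.add_apply, Measure.smul_apply, Measure.smul_apply,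
    Measure.map_apply (measurable_cat _) hE, Measure.map_apply (measurable_cat _) hE]
  rfl

theorem measurableSet_cyl (w : List Bool) : MeasurableSet (cyl w) := (isOpen_cyl w).measurableSet

/-- What follows a fixed prefix is again distributed as `coin`. Induct on the prefix with the
first-bit decomposition; the half with the wrong first bit contributes nothing. -/
theorem coin_cyl_inter (w : List Bool) {E : Set Cantor} (hE : MeasurableSet E) :
    coin (cyl w ∩ E) = 2⁻¹ ^ w.length * coin (cat w ⁻¹' E) := by
  induction w generalizing E with
  | nil =>
    have h1 : cyl [] = Set.univ := by ext x; simp [cyl, pre]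
    have h2 : (cat [] : Cantor → Cantor) = id := by funext x; exact cat_nil x
    simp [h1, h2]
  | cons b w ih =>
    have h1 : cat [b] ⁻¹' (cyl (b :: w) ∩ E) = cyl w ∩ (cat [b] ⁻¹' E) := by
      ext x
      simp only [Set.mem_preimage, Set.mem_inter_iff]
      rw [show b :: w = [b] ++ w from rfl, cat_mem_cyl_append]
    have h2 : cat [!b] ⁻¹' (cyl (b :: w) ∩ E) = ∅ := by
      ext x
      simp only [Set.mem_preimage, Set.mem_inter_iff, Set.mem_empty_iff_false, iff_false, not_and]
      intro h
      have := (eq_pre_iff.mp (mem_cyl.mp h).symm).2 0 (by simp)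
      simp [cat] at this
    have h3 : cat (b :: w) ⁻¹' E = cat w ⁻¹' (cat [b] ⁻¹' E) := by
      ext x
      simp only [Set.mem_preimage]
      rw [show b :: w = [b] ++ w from rfl, cat_append]
    rw [coin_eq ((measurableSet_cyl _).inter hE), h3, List.length_cons, pow_succ', mul_assoc,
      ← ih (measurable_cat _ hE)]
    cases b
    · rw [h1, show cat [true] ⁻¹' (cyl (false :: w) ∩ E) = ∅ from h2]; simp
    · rw [h1, show cat [false] ⁻¹' (cyl (true :: w) ∩ E) = ∅ from h2]; simp

theorem coin_cyl (w : List Bool) : coin (cyl w) = 2⁻¹ ^ w.length := by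
  simpa using coin_cyl_inter w MeasurableSet.univ

theorem coin_cyl_pos (w : List Bool) : 0 < coin (cyl w) := by
  rw [coin_cyl]
  exact ENNReal.pow_pos (by simp) _

theorem coin_cat_preimage_le (b : Bool) {E : Set Cantor} (hE : MeasurableSet E) :
    coin (cat [b] ⁻¹' E) ≤ 2 * coin E := by
  have h := coin_cyl_inter [b] hE
  have h2 : coin (cat [b] ⁻¹' E) = 2 * coin (cyl [b] ∩ E) := by
    rw [h, ← mul_assoc]
    simp [ENNReal.mul_inv_cancel]
  rw [h2]
  gcongr
  exact Set.inter_subset_right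

theorem measurable_shift : Measurable shift :=
  measurable_pi_iff.mpr fun _ => measurable_pi_apply _

theorem measurable_shift_iterate (n : ℕ) : Measurable shift^[n] := measurable_shift.iterate n

theorem coin_shift_preimage {E : Set Cantor} (hE : MeasurableSet E) :
    coin (shift ⁻¹' E) = coin E := by
  have h : ∀ b, cat [b] ⁻¹' (shift ⁻¹' E) = E := by
    intro b
    ext x
    simp only [Set.mem_preimage]
    rw [show shift (cat [b] x) = x from shift_iterate_cat [b] x]
  rw [coin_eq (measurable_shift hE), h, h, ← add_mul, ENNReal.inv_two_add_inv_two, one_mul]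

theorem coin_shift_iterate_preimage (n : ℕ) {E : Set Cantor} (hE : MeasurableSet E) :
    coin (shift^[n] ⁻¹' E) = coin E := by
  induction n with
  | zero => simp
  | succ n ih =>
    rw [Function.iterate_succ', Set.preimage_comp, ← ih, ← coin_shift_preimage
      (measurable_shift_iterate n hE), ← Set.preimage_comp, ← Set.preimage_comp,
      ← Function.iterate_succ', ← Function.iterate_succ]

/-! ### Avoiding a word on disjoint blocks -/

/-- The sequences in which none of the first `n` blocks of length `|u|` equals `u`. -/
def avoids (u : List Bool) (n : ℕ) : Set Cantor :=
  {x | ∀ j < n, shift^[u.length * j] x ∉ cyl u}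

theorem measurableSet_avoids (u : List Bool) (n : ℕ) : MeasurableSet (avoids u n) := by
  have : avoids u n = ⋂ j ∈ Set.Iio n, (shift^[u.length * j] ⁻¹' cyl u)ᶜ := by
    ext x; simp [avoids]
  rw [this]
  exact MeasurableSet.biInter (Set.to_countable _) fun j _ =>
    (measurable_shift_iterate _ (measurableSet_cyl u)).compl

/-- Split the event that blocks `1, ..., n` all differ from `u` according to whether block 0 equals
`u`; disjoint blocks are independent. -/
theorem coin_avoids_add (u : List Bool) (n : ℕ) :
    2⁻¹ ^ u.length * coin (avoids u n) + coin (avoids u (n + 1)) = coin (avoids u n) := by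
  have hm := measurable_shift_iterate u.length (measurableSet_avoids u n)
  have h1 : coin (cyl u ∩ shift^[u.length] ⁻¹' avoids u n) = 2⁻¹ ^ u.length * coin (avoids u n) := by
    rw [coin_cyl_inter u hm]
    congr 2
    ext x
    simp only [Set.mem_preimage, shift_iterate_cat]
  have h2 : avoids u (n + 1) = (shift^[u.length] ⁻¹' avoids u n) \ cyl u := by
    ext x
    simp only [avoids, Set.mem_ofPred_eq, Set.mem_sdiff, Set.mem_preimage,
      ← Function.iterate_add_apply]
    constructor
    · intro h
      refine ⟨fun j hj => ?_, by simpa using h 0 (by omega)⟩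
      have := h (j + 1) (by omega)
      rwa [mul_add, mul_one] at this
    · rintro ⟨h, h0⟩ j hj
      rcases j with _ | j
      · simpa using h0
      · rw [mul_add, mul_one]; exact h j (by omega)
  rw [← h1, h2, Set.inter_comm, measure_inter_add_sdiff _ (measurableSet_cyl u),
    coin_shift_iterate_preimage _ (measurableSet_avoids u n)]

theorem coin_avoids (u : List Bool) (n : ℕ) :
    coin (avoids u n) = (1 - 2⁻¹ ^ u.length) ^ n := by
  induction n with
  | zero => simp [avoids]
  | succ n ih =>
    have h := coin_avoids_add u n
    have hfin : 2⁻¹ ^ u.length * coin (avoids u n) ≠ ∞ :=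
      ENNReal.mul_ne_top (by simp) (measure_ne_top _ _)
    rw [pow_succ, ← ih, ENNReal.mul_sub (fun _ _ => measure_ne_top _ _), mul_one, mul_comm _ (2⁻¹ ^ _)]
    exact ENNReal.eq_sub_of_add_eq hfin (by rw [add_comm]; exact h)

/-- The measure decays geometrically in the number of blocks; `c` is the number of blocks that
pushes it below one half. This supplies the bound of a Martin-Löf test. -/
theorem exists_coin_avoids_le (u : List Bool) : ∃ c : ℕ, ∀ i, coin (avoids u (c * i)) ≤ 2⁻¹ ^ i := by
  have hlt : (1 : ℝ≥0∞) - 2⁻¹ ^ u.length < 1 :=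
    ENNReal.sub_lt_self (by simp) (by simp) (ENNReal.pow_pos (by simp) _).ne'
  have := ENNReal.tendsto_pow_atTop_nhds_zero_of_lt_one hlt
  obtain ⟨c, hc⟩ := (this.eventually (gt_mem_nhds (show (0 : ℝ≥0∞) < 2⁻¹ by simp))).exists
  refine ⟨c, fun i => ?_⟩
  rw [coin_avoids, pow_mul]
  gcongr

/-! ### Computability -/

section Computability

variable {α β σ : Type} [Primcodable α] [Primcodable β] [Primcodable σ]

theorem Computable.pre {y : α → ℕ → β} {n : α → ℕ} (hy : Computable₂ y) (hn : Computable n) :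
    Computable fun a => pre (y a) (n a) := by
  have : Computable fun a => (Nat.rec [] (fun i l => l ++ [y a i]) (n a) : List β) :=
    Computable.nat_rec (h := fun a p => p.2 ++ [y a p.1]) hn (Computable.const [])
      (Computable.list_concat.comp (Computable.snd.comp Computable.snd)
        (hy.comp Computable.fst (Computable.fst.comp Computable.snd)))
  refine this.of_eq fun a => ?_
  induction n a with
  | zero => rfl
  | succ k ih => rw [pre_succ, ← ih]

theorem Computable.cat {w : α → List β} {y : α → ℕ → β} {n : α → ℕ} (hw : Computable w)
    (hy : Computable₂ y) (hn : Computable n) : Computable fun a => cat (w a) (y a) (n a) := by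
  have : Computable fun a => ((w a)[n a]?).getD (y a (n a - (w a).length)) :=
    Computable.option_getD (Computable.list_getElem?.comp hw hn)
      (hy.comp Computable.id (Primrec.nat_sub.to_comp.comp hn (Computable.list_length.comp hw)))
  refine this.of_eq fun a => ?_
  rw [HittingTime.cat, List.getD_eq_getElem?_getD]

/-- `bex n f` tells whether `f i` holds for some `i < n`. -/
def bex (n : ℕ) (f : ℕ → Bool) : Bool := Nat.rec false (fun i b => b || f i) n

theorem bex_iff {n : ℕ} {f : ℕ → Bool} : bex n f = true ↔ ∃ i < n, f i = true := by
  induction n with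
  | zero => simp [bex]
  | succ n ih =>
    have : bex (n + 1) f = (bex n f || f n) := rfl
    rw [this, Bool.or_eq_true, ih]
    constructor
    · rintro (⟨i, hi, h⟩ | h)
      · exact ⟨i, by omega, h⟩
      · exact ⟨n, by omega, h⟩
    · rintro ⟨i, hi, h⟩
      rcases Nat.lt_succ_iff_lt_or_eq.mp hi with hi | rfl
      · exact Or.inl ⟨i, hi, h⟩
      · exact Or.inr h

theorem not_bex_not_iff {n : ℕ} {f : ℕ → Bool} :
    (!bex n fun i => !f i) = true ↔ ∀ i < n, f i = true := by
  rw [Bool.not_eq_true', Bool.eq_false_iff, ne_eq, bex_iff]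
  simp

theorem bex_congr {n : ℕ} {f g : ℕ → Bool} (h : ∀ i < n, f i = g i) : bex n f = bex n g := by
  rw [Bool.eq_iff_iff, bex_iff, bex_iff]
  exact exists_congr fun i => and_congr_right fun hi => by rw [h i hi]

theorem Computable.or {f g : α → Bool} (hf : Computable f) (hg : Computable g) :
    Computable fun a => f a || g a := Primrec.or.to_comp.comp hf hg

theorem Computable.and {f g : α → Bool} (hf : Computable f) (hg : Computable g) :
    Computable fun a => f a && g a := Primrec.and.to_comp.comp hf hg

theorem Computable.not {f : α → Bool} (hf : Computable f) :
    Computable fun a => !f a := Primrec.not.to_comp.comp hf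

theorem Computable.bex {n : α → ℕ} {f : α → ℕ → Bool} (hn : Computable n) (hf : Computable₂ f) :
    Computable fun a => bex (n a) (f a) :=
  Computable.nat_rec (h := fun a p => p.2 || f a p.1) hn (Computable.const false)
    (Computable.or (Computable.snd.comp Computable.snd)
      (hf.comp Computable.fst (Computable.fst.comp Computable.snd)))

theorem Computable.beq [DecidableEq β] {f g : α → β} (hf : Computable f) (hg : Computable g) :
    Computable fun a => decide (f a = g a) := by
  have h : Primrec₂ fun a b : β => decide (a = b) := (Primrec.eq (α := β)).decide
  exact h.to_comp.comp hf hg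

theorem Computable.add {f g : α → ℕ} (hf : Computable f) (hg : Computable g) :
    Computable fun a => f a + g a := Primrec.nat_add.to_comp.comp hf hg

theorem Computable.mul {f g : α → ℕ} (hf : Computable f) (hg : Computable g) :
    Computable fun a => f a * g a := Primrec.nat_mul.to_comp.comp hf hg

theorem Computable.ite {c : α → Bool} {f g : α → σ} (hc : Computable c) (hf : Computable f)
    (hg : Computable g) : Computable fun a => if c a = true then f a else g a :=
  (Computable.cond hc hf hg).of_eq fun _ => Bool.cond_eq_ite _ _ _

theorem computable_two_pow : Computable fun n : ℕ => 2 ^ n := by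
  have : Computable fun n : ℕ => (Nat.rec 1 (fun _ m => m + m) n : ℕ) :=
    Computable.nat_rec (h := fun _ p => p.2 + p.2) Computable.id (Computable.const 1)
      (Computable.add (Computable.snd.comp Computable.snd) (Computable.snd.comp Computable.snd))
  refine this.of_eq fun n => ?_
  induction n with
  | zero => rfl
  | succ k ih => rw [pow_succ, ← ih]; simp only; omega

theorem computable_testBit : Computable₂ Nat.testBit := by
  have : Computable₂ fun a b : ℕ => decide (a / 2 ^ b % 2 = 1) :=
    Computable.beq (Primrec.nat_mod.to_comp.comp
      (Primrec.nat_div.to_comp.comp Computable.fst (computable_two_pow.comp Computable.snd))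
      (Computable.const 2)) (Computable.const 1)
  refine Computable.of_eq this fun p => ?_
  rw [Nat.testBit_eq_decide_div_mod_eq]

/-! ### Stagewise membership in an enumerated open set -/

/-- One of the first `s` entries of `r` lists a prefix of `y` shorter than `s`. -/
def cov (r : Baire) (y : Cantor) (s : ℕ) : Bool :=
  bex s fun n => bex s fun i => decide (r i = Encodable.encode (pre y n) + 1)

theorem cov_iff {r : Baire} {y : Cantor} {s : ℕ} :
    cov r y s = true ↔ ∃ n < s, ∃ i < s, r i = Encodable.encode (pre y n) + 1 := by
  simp only [cov, bex_iff, decide_eq_true_eq]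

theorem cov_mono {r : Baire} {y : Cantor} {s t : ℕ} (hst : s ≤ t) (h : cov r y s = true) :
    cov r y t = true := by
  rw [cov_iff] at h ⊢
  obtain ⟨n, hn, i, hi, h⟩ := h
  exact ⟨n, by omega, i, by omega, h⟩

theorem cov_congr {r r' : Baire} {y y' : Cantor} {s : ℕ} (hr : ∀ i < s, r i = r' i)
    (hy : ∀ i < s, y i = y' i) : cov r y s = cov r' y' s := by
  refine bex_congr fun n hn => bex_congr fun i hi => ?_
  rw [hr i hi, pre_eq_iff.mpr fun j hj => hy j (hj.trans hn)]

theorem cov_zero (r : Baire) (y : Cantor) : cov r y 0 = false := rfl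

theorem mem_listed_iff {r : Baire} {x : Cantor} : x ∈ listed r ↔ ∃ s, cov r x s = true := by
  constructor
  · rintro ⟨i, w, hi, hx⟩
    refine ⟨i + w.length + 1, cov_iff.mpr ⟨w.length, by omega, i, by omega, ?_⟩⟩
    rw [hi, mem_cyl.mp hx]
  · rintro ⟨s, h⟩
    obtain ⟨n, -, i, -, h⟩ := cov_iff.mp h
    exact ⟨i, pre x n, h, self_mem_cyl_pre x n⟩

theorem Computable.cov {r : α → ℕ → ℕ} {y : α → ℕ → Bool} {s : α → ℕ} (hr : Computable₂ r)
    (hy : Computable₂ y) (hs : Computable s) : Computable fun a => cov (r a) (y a) (s a) := by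
  refine Computable.bex hs (Computable.bex (hs.comp Computable.fst) ?_)
  refine Computable.beq
    (hr.comp (Computable.fst.comp Computable.fst) Computable.snd)
    (Computable.succ.comp (Computable.encode.comp ?_))
  exact Computable.pre (y := fun (p : (α × ℕ) × ℕ) => y p.1.1)
    (hy.comp ((Computable.fst.comp Computable.fst).comp Computable.fst) Computable.snd)
    (Computable.snd.comp Computable.fst)

/-! ### Guessing the least survivor -/

/-- The current guess at stage `n` of the least `m` for which `D m` never holds. -/
def guess (D : ℕ → ℕ → Bool) (n : ℕ) : ℕ := Nat.rec 0 (fun i g => if D g i = true then g + 1 else g) n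

theorem guess_succ (D : ℕ → ℕ → Bool) (n : ℕ) :
    guess D (n + 1) = if D (guess D n) n = true then guess D n + 1 else guess D n := rfl

theorem guess_le (D : ℕ → ℕ → Bool) (n : ℕ) : guess D n ≤ n := by
  induction n with
  | zero => exact le_rfl
  | succ n ih => rw [guess_succ]; split_ifs <;> omega

theorem exists_of_lt_guess {D : ℕ → ℕ → Bool} {n m : ℕ} (h : m < guess D n) :
    ∃ s, D m s = true := by
  induction n with
  | zero => exact absurd h (Nat.not_lt_zero m)
  | succ n ih =>
    rw [guess_succ] at h
    split_ifs at h with hd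
    · rcases Nat.lt_succ_iff_lt_or_eq.mp h with h | rfl
      · exact ih h
      · exact ⟨n, hd⟩
    · exact ih h

theorem guess_mono (D : ℕ → ℕ → Bool) : Monotone (guess D) :=
  monotone_nat_of_le_succ fun n => by rw [guess_succ]; split_ifs <;> omega

/-- If some `m` survives, only finitely many guesses do not survive. -/
theorem exists_guess_eventually {D : ℕ → ℕ → Bool}
    (hD : ∀ m s t, s ≤ t → D m s = true → D m t = true)
    (h : ∃ m, ∀ s, D m s = false) : ∃ n₀, ∀ n ≥ n₀, ∀ s, D (guess D n) s = false := by
  classical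
  obtain ⟨N, hN, hmin⟩ : ∃ N, (∀ s, D N s = false) ∧ ∀ m < N, ∃ s, D m s = true := by
    refine ⟨Nat.find h, Nat.find_spec h, fun m hm => ?_⟩
    simpa using Nat.find_min h hm
  have hle : ∀ n, guess D n ≤ N := by
    intro n
    by_contra! hc
    obtain ⟨s, hs⟩ := exists_of_lt_guess hc
    simp [hN] at hs
  -- Monotonicity of `D` matters here: a refutation of `m` found before the guess arrives at `m` is
  -- still visible when it does.
  have hreach : ∀ m ≤ N, ∃ n, m ≤ guess D n := by
    intro m
    induction m with
    | zero => exact fun _ => ⟨0, le_rfl⟩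
    | succ m ih =>
      intro hm
      obtain ⟨n, hn⟩ := ih (by omega)
      obtain ⟨s, hs⟩ := hmin m (by omega)
      refine ⟨max n s + 1, ?_⟩
      have h1 : m ≤ guess D (max n s) := hn.trans (guess_mono D (le_max_left n s))
      rcases h1.lt_or_eq with h1 | h1
      · exact Nat.succ_le_of_lt (h1.trans_le (guess_mono D (Nat.le_succ _)))
      · rw [guess_succ, ← h1, if_pos (hD m s _ (le_max_right n s) hs)]
  obtain ⟨n₀, hn₀⟩ := hreach N le_rfl
  refine ⟨n₀, fun n hn => ?_⟩
  rw [le_antisymm (hle n) (hn₀.trans (guess_mono D hn))]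
  exact hN

/-- At stage `i` the guess is at most `i`, so only the entries `D m i` with `m ≤ i` are consulted.
This bounds the part of the input that is read. -/
theorem guess_congr {D D' : ℕ → ℕ → Bool} {n : ℕ} (h : ∀ m i, m ≤ i → i < n → D m i = D' m i) :
    guess D n = guess D' n := by
  induction n with
  | zero => rfl
  | succ n ih =>
    have ih' := ih fun m i hm hi => h m i hm (by omega)
    rw [guess_succ, guess_succ, ← ih', h _ n (guess_le D n) (by omega)]

theorem Computable.guess {D : α → ℕ → ℕ → Bool} {n : α → ℕ}
    (hD : Computable fun q : α × ℕ × ℕ => D q.1 q.2.1 q.2.2) (hn : Computable n) :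
    Computable fun a => guess (D a) (n a) := by
  refine Computable.nat_rec (h := fun a p => if D a p.2 p.1 = true then p.2 + 1 else p.2) hn
    (Computable.const 0) ?_
  refine Computable.ite ?_ (Computable.succ.comp (Computable.snd.comp Computable.snd))
    (Computable.snd.comp Computable.snd)
  exact hD.comp (Computable.fst.pair ((Computable.snd.comp Computable.snd).pair
    (Computable.fst.comp Computable.snd)))

end Computability

/-! ### Computable functions on Baire space -/

/-- The finite word `x` followed by zeros. -/
def pad (x : List ℕ) : Baire := cat x fun _ => 0

theorem pad_pre (p : Baire) {s i : ℕ} (h : i < s) : pad (pre p s) i = p i := by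
  rw [pad, cat_of_lt _ _ (by rwa [length_pre]), getElem_pre]

/-- A function whose `n`-th output can be computed from linearly many entries of the input. -/
structure LinearUse (F : Baire → ℕ → ℕ) : Prop where
  computable : Computable₂ fun x n => F (pad x) n
  use : ∃ c > 0, ∀ p q n, (∀ i < c * (n + 1), p i = q i) → F p n = F q n

/-- An input word of length `s` determines the first `s / c` outputs, so these can be computed from
the word padded with zeros. -/
theorem LinearUse.computableB {F : Baire → ℕ → ℕ} (h : LinearUse F) :
    ComputableB fun p => Part.some (F p) := by
  obtain ⟨c, hc, hF⟩ := h.use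
  refine ⟨fun x => pre (F (pad x)) (x.length / c), ?_, ?_⟩
  · exact Computable.pre h.computable (Primrec.nat_div.to_comp.comp Computable.list_length (Computable.const c))
  · intro p q hq
    obtain rfl : q = F p := Part.mem_some_iff.mp hq
    refine ⟨fun s => ⟨s / c, ?_⟩, fun t => ⟨c * t, ?_⟩⟩
    · simp only [length_pre]
      rw [pre_eq_iff]
      refine fun n hn => hF _ _ _ fun i hi => pad_pre p (hi.trans_le ?_)
      exact (Nat.mul_le_mul_left c hn).trans (Nat.mul_div_le s c)
    · simp only [length_pre]
      rw [Nat.mul_div_cancel_left _ hc]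

/-- The function that returns the value `F r (b 0)` on the input `pairB r b`. -/
theorem LinearUse.computableB_eval {F : Baire → ℕ → ℕ} (h : LinearUse F) :
    ComputableB fun p => Part.some fun _ => F (fun n => p (2 * n)) (p 1) := by
  obtain ⟨c, hc, hF⟩ := h.use
  have hpad : Computable₂ fun (x : List ℕ) (n : ℕ) => pad x n :=
    Computable.cat Computable.fst (Computable.const 0).to₂ Computable.snd
  let y : List ℕ → List ℕ := fun x => pre (fun n => pad x (2 * n)) x.length
  have hy : Computable y := Computable.pre
    (hpad.comp Computable.fst (Computable.mul (Computable.const 2) Computable.snd))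
    Computable.list_length
  have hone : Computable fun x => pad x 1 := hpad.comp Computable.id (Computable.const 1)
  -- Nothing is written until enough of the input is known: the entries of `r` sit at even places,
  -- whence the factor 2, and the index is entry 1. The truncated difference being 0 expresses `≤`;
  -- the length `x.length - 1` is 0 while entry 1 is unread.
  refine ⟨fun x => pre (fun _ => F (pad (y x)) (pad x 1))
    (if decide (2 * (c * (pad x 1 + 1)) - x.length = 0) = true then x.length - 1 else 0), ?_, ?_⟩
  · refine Computable.pre ?_ (Computable.ite (Computable.beq ?_ (Computable.const 0))
      (Primrec.nat_sub.to_comp.comp Computable.list_length (Computable.const 1)) (Computable.const 0))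
    · exact h.computable.comp (hy.comp Computable.fst) (hone.comp Computable.fst)
    · exact Primrec.nat_sub.to_comp.comp (Computable.mul (Computable.const 2)
        (Computable.mul (Computable.const c) (Computable.succ.comp hone))) Computable.list_length
  · intro p q hq
    obtain rfl := Part.mem_some_iff.mp hq
    have key : ∀ s, 1 < s → 2 * (c * (p 1 + 1)) ≤ s →
        F (pad (y (pre p s))) (p 1) = F (fun n => p (2 * n)) (p 1) := by
      intro s h1 hs
      refine hF _ _ _ fun i hi => ?_
      have hi' : i < s := by omega
      simp only [y, length_pre]
      rw [pad_pre _ hi', pad_pre p (by omega)]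
    constructor
    · intro s
      simp only [length_pre]
      by_cases h1 : 1 < s
      · rw [pad_pre p h1]
        by_cases hs : 2 * (c * (p 1 + 1)) ≤ s
        · refine ⟨s - 1, ?_⟩
          rw [if_pos (by simp; omega), key s h1 hs]
        · refine ⟨0, ?_⟩
          rw [if_neg (by simp; omega)]
          rfl
      · refine ⟨0, ?_⟩
        split_ifs
        · rw [show s - 1 = 0 by omega]; simp only [pre, List.range_zero, List.map_nil]
        · rfl
    · intro t
      refine ⟨t + 2 + 2 * (c * (p 1 + 1)), ?_⟩
      simp only [length_pre]
      rw [pad_pre p (by omega), if_pos (by simp only [decide_eq_true_eq]; omega)]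
      omega

/-! ### Names of open sets -/

/-- A decidable stage predicate that reads only `s` bits at stage `s` defines an open set: list
exactly those words that it accepts at the stage equal to their length. -/
theorem exists_computable_listed {β : Type} [Primcodable β] {C : β → Cantor → ℕ → Bool}
    (hC : Computable fun q : (β × List Bool) × ℕ => C q.1.1 (cat q.1.2 fun _ => false) q.2)
    (hcongr : ∀ b x y s, (∀ i < s, x i = y i) → C b x s = C b y s) :
    ∃ e : β → ℕ → ℕ, Computable₂ e ∧ ∀ b, listed (e b) = {x | ∃ s, C b x s = true} := by
  let wd : ℕ → List Bool := fun n => (Encodable.decode n).getD []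
  have hwd : Computable wd := Computable.option_getD Computable.decode (Computable.const [])
  have hwd_encode : ∀ w : List Bool, wd (Encodable.encode w) = w := fun w => by
    simp only [wd, Encodable.encodek, Option.getD_some]
  refine ⟨fun b n => if C b (cat (wd n) fun _ => false) (wd n).length = true then n + 1 else 0,
    ?_, fun b => ?_⟩
  · have hw : Computable fun q : β × ℕ => wd q.2 := hwd.comp Computable.snd
    exact Computable.ite (hC.comp ((Computable.fst.pair hw).pair (Computable.list_length.comp hw)))
      (Computable.succ.comp Computable.snd) (Computable.const 0)
  · ext x
    constructor
    · rintro ⟨n, w, hn, hx⟩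
      beta_reduce at hn
      split_ifs at hn with h
      · obtain rfl : n = Encodable.encode w := by omega
        rw [hwd_encode] at h
        refine ⟨w.length, ?_⟩
        rw [← h]
        refine hcongr _ _ _ _ fun i hi => ?_
        rw [cat_of_lt _ _ hi]
        exact ((eq_pre_iff.mp (mem_cyl.mp hx).symm).2 i hi).symm
    · rintro ⟨s, hs⟩
      refine ⟨Encodable.encode (pre x s), pre x s, ?_, self_mem_cyl_pre x s⟩
      beta_reduce
      rw [hwd_encode, if_pos]
      rw [length_pre, ← hs]
      refine hcongr _ _ _ _ fun i hi => ?_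
      rw [cat_of_lt _ _ (by rwa [length_pre]), getElem_pre]

theorem exists_isMLTest {C : ℕ → Cantor → ℕ → Bool}
    (hC : Computable fun q : (ℕ × List Bool) × ℕ => C q.1.1 (cat q.1.2 fun _ => false) q.2)
    (hcongr : ∀ b x y s, (∀ i < s, x i = y i) → C b x s = C b y s)
    (hcoin : ∀ i, coin {x | ∃ s, C i x s = true} ≤ 2⁻¹ ^ i) :
    ∃ V : ℕ → Opens Cantor, IsMLTest V ∧ ∀ i, (V i : Set Cantor) = {x | ∃ s, C i x s = true} := by
  obtain ⟨e, he, heq⟩ := exists_computable_listed hC hcongr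
  refine ⟨fun i => ⟨listed (e i), isOpen_listed _⟩, ⟨⟨e, he, fun i => rfl⟩, fun i => ?_⟩, heq⟩
  change coin (listed (e i)) ≤ _
  rw [heq]
  exact hcoin i

theorem Computable.catFalse {α : Type} [Primcodable α] {w : α → List Bool} {n : α → ℕ} (hw : Computable w)
    (hn : Computable n) : Computable fun a => HittingTime.cat (w a) (fun _ => false) (n a) :=
  Computable.cat hw (Computable.const false).to₂ hn

/-! ### Random sequences -/

/-- The sequence is computable, so the cylinders around its own prefixes form a test that catches
it. -/
theorem not_isMLRandom_cat_zeros (w : List Bool) : ¬ IsMLRandom (cat w fun _ => false) := by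
  obtain ⟨V, hV, hVeq⟩ := exists_isMLTest
    (C := fun i x s => decide (s = w.length + i) && decide (pre x s = pre (cat w fun _ => false) s))
    (by
      refine Computable.and (Computable.beq Computable.snd (Computable.add (Computable.const _)
        (Computable.fst.comp Computable.fst))) (Computable.beq ?_ ?_)
      · refine Computable.pre (y := fun (q : (ℕ × List Bool) × ℕ) => cat q.1.2 fun _ => false) ?_ Computable.snd
        exact Computable.catFalse ((Computable.snd.comp Computable.fst).comp Computable.fst) Computable.snd
      · refine Computable.pre (y := fun (q : (ℕ × List Bool) × ℕ) => cat w fun _ => false) ?_ Computable.snd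
        exact Computable.catFalse (Computable.const w) Computable.snd)
    (by
      intro i x y s h
      rw [pre_eq_iff.mpr h])
    (by
      intro i
      have : {x : Cantor | ∃ s, (decide (s = w.length + i) &&
          decide (pre x s = pre (cat w fun _ => false) s)) = true} =
          cyl (pre (cat w fun _ => false) (w.length + i)) := by
        ext x; simp [mem_cyl, length_pre]
      rw [this, coin_cyl, length_pre]
      exact pow_le_pow_of_le_one (by simp) (by simp) (by omega))
  intro h
  refine h V hV (Set.mem_iInter.mpr fun i => ?_)
  rw [hVeq]
  exact ⟨w.length + i, by simp⟩

/-- Pulling a test back along the prepending of a bit at most doubles the measures; passing from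
index `i` to `i + 1` compensates for this. -/
theorem IsMLRandom.cat_singleton {x : Cantor} (hx : IsMLRandom x) (b : Bool) :
    IsMLRandom (cat [b] x) := by
  intro V hV hmem
  obtain ⟨⟨e, he, hname⟩, hcoin⟩ := hV
  have hmemV : ∀ i y, y ∈ (V i : Set Cantor) ↔ ∃ s, cov (e i) y s = true := by
    intro i y
    rw [← mem_listed_iff]
    exact Set.ext_iff.mp (hname i).symm y
  have hset : ∀ i, {x : Cantor | ∃ s, cov (e (i + 1)) (cat [b] x) s = true} =
      cat [b] ⁻¹' (V (i + 1) : Set Cantor) := by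
    intro i
    ext y
    rw [Set.mem_preimage, hmemV]
    rfl
  obtain ⟨W, hW, hWeq⟩ := exists_isMLTest
    (C := fun i x s => cov (e (i + 1)) (cat [b] x) s)
    (by
      refine Computable.cov (r := fun (q : (ℕ × List Bool) × ℕ) => e (q.1.1 + 1))
        (y := fun q => cat [b] (cat q.1.2 fun _ => false)) ?_ ?_ Computable.snd
      · exact he.comp (Computable.succ.comp ((Computable.fst.comp Computable.fst).comp Computable.fst))
          Computable.snd
      · refine Computable.cat (Computable.const [b]) ?_ Computable.snd
        exact Computable.catFalse (((Computable.snd.comp Computable.fst).comp Computable.fst).comp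
          Computable.fst) Computable.snd)
    (by
      intro i x y s h
      exact cov_congr (fun _ _ => rfl) fun j hj => cat_congr [b] h j (by omega))
    (by
      intro i
      rw [hset]
      refine (coin_cat_preimage_le b (V (i + 1)).isOpen.measurableSet).trans ?_
      refine (mul_le_mul_right (hcoin (i + 1)) 2).trans ?_
      rw [pow_succ', ← mul_assoc, ENNReal.mul_inv_cancel (by simp) (by simp), one_mul])
  refine hx W hW (Set.mem_iInter.mpr fun i => ?_)
  rw [hWeq, hset]
  exact Set.mem_iInter.mp hmem (i + 1)

theorem IsMLRandom.cat {x : Cantor} (hx : IsMLRandom x) (w : List Bool) :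
    IsMLRandom (HittingTime.cat w x) := by
  induction w with
  | nil => rwa [cat_nil]
  | cons b w ih =>
    rw [show b :: w = [b] ++ w from rfl, cat_append]
    exact ih.cat_singleton b

/-- A sequence that never meets `u` avoids it in particular on the disjoint blocks of length `|u|`.
Avoidance on the first `c * i` blocks is decided by `|u| * (c * i)` bits, so these events form a
test. -/
theorem IsMLRandom.exists_shift_mem_cyl {x : Cantor} (hx : IsMLRandom x) (u : List Bool) :
    ∃ n, shift^[n] x ∈ cyl u := by
  by_contra! hno
  obtain ⟨c, hc⟩ := exists_coin_avoids_le u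
  have hset : ∀ i, {x : Cantor | ∃ s, (decide (s = u.length * (c * i)) && !bex (c * i) fun j =>
      decide (pre (fun t => x (u.length * j + t)) u.length = u)) = true} = avoids u (c * i) := by
    intro i
    ext y
    simp only [Set.mem_ofPred_eq, Bool.and_eq_true, decide_eq_true_eq, exists_eq_left, avoids,
      Bool.not_eq_true', Bool.eq_false_iff, ne_eq, bex_iff, not_exists, not_and, mem_cyl, shift_iterate]
  obtain ⟨V, hV, hVeq⟩ := exists_isMLTest
    (C := fun i x s => decide (s = u.length * (c * i)) && !bex (c * i) fun j =>
      decide (pre (fun t => x (u.length * j + t)) u.length = u))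
    (by
      have hi : Computable fun q : (ℕ × List Bool) × ℕ => c * q.1.1 :=
        Computable.mul (Computable.const c) (Computable.fst.comp Computable.fst)
      refine Computable.and (Computable.beq Computable.snd (Computable.mul (Computable.const _) hi))
        (Computable.not (Computable.bex hi (Computable.beq ?_ (Computable.const u))))
      refine Computable.pre (y := fun (q : ((ℕ × List Bool) × ℕ) × ℕ) t =>
        HittingTime.cat q.1.1.2 (fun _ => false) (u.length * q.2 + t)) ?_ (Computable.const _)
      refine Computable.catFalse ?_ (Computable.add (Computable.mul (Computable.const _)
        (Computable.snd.comp Computable.fst)) Computable.snd)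
      exact ((Computable.snd.comp Computable.fst).comp Computable.fst).comp Computable.fst)
    (by
      intro i x y s h
      by_cases hs : s = u.length * (c * i)
      · congr 2
        refine bex_congr fun j hj => ?_
        congr 2
        refine pre_eq_iff.mpr fun t ht => h _ ?_
        calc u.length * j + t < u.length * j + u.length := by omega
          _ = u.length * (j + 1) := by ring
          _ ≤ u.length * (c * i) := Nat.mul_le_mul_left _ hj
          _ = s := hs.symm
      · simp [hs])
    (by
      intro i
      rw [hset]
      exact hc i)
  refine hx V hV (Set.mem_iInter.mpr fun i => ?_)
  rw [hVeq, hset]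
  exact fun j _ => hno _

/-! ### Names -/

/-- The binary sequence that a point of Baire space stands for. -/
def toCantor (p : Baire) : Cantor := fun n => !decide (p n = 0)

theorem toCantor_toNat (x : Cantor) : toCantor (fun n => (x n).toNat) = x := by
  funext n
  cases h : x n <;> simp [toCantor, h]

theorem toCantor_congr {p q : Baire} {n : ℕ} (h : p n = q n) : toCantor p n = toCantor q n := by
  simp only [toCantor, h]

theorem computable_pad : Computable₂ pad :=
  Computable.cat Computable.fst (Computable.const 0).to₂ Computable.snd

theorem computable_toCantor_pad : Computable₂ fun x n => toCantor (pad x) n :=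
  Computable.not (Computable.beq computable_pad (Computable.const 0))

theorem isName_mlr {p : Baire} {x : MLR} : IsName p x ↔ p = fun n => (x.1 n).toNat := Iff.rfl

theorem isName_nat {p : Baire} {n : ℕ} : IsName p n ↔ p 0 = n := Iff.rfl

theorem isName_posClosed {p : Baire} {A : PosClosed} :
    IsName p A ↔ ∀ x, x ∈ A.1 ↔ x ∉ listed p := by
  have h : IsName p A ↔ listed p = (A.1 : Set Cantor)ᶜ := Iff.rfl
  rw [h, Set.ext_iff]
  refine forall_congr' fun x => ?_
  rw [Set.mem_compl_iff, SetLike.mem_coe]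
  tauto

theorem pairB_one (p q : Baire) : pairB p q 1 = q 0 := rfl

/-! ### The reduction of LAY to the hitting time -/

section LayToHitting

variable (e : ℕ → ℕ → ℕ)

/-- The layer that `y` is believed to have at stage `n`. -/
def layGuess (y : Cantor) (n : ℕ) : ℕ := guess (fun k s => cov (e k) y s) n

/-- The enumeration of the cylinders around those iterates `shift^[m] y` for which the guess at
stage `m` is wrong. -/
def avoidName (y : Cantor) (n : ℕ) : ℕ :=
  if cov (e (layGuess e y n.unpair.1)) y n.unpair.2 = true then
    Encodable.encode (pre (fun t => y (n.unpair.1 + t)) (n.unpair.1 + 1)) + 1 else 0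

theorem layGuess_congr {y z : Cantor} {n : ℕ} (h : ∀ i < n, y i = z i) :
    layGuess e y n = layGuess e z n :=
  guess_congr fun _ i _ hi => cov_congr (fun _ _ => rfl) fun j hj => h j (by omega)

/-- The widest read is the listed word: it ends before position `2 * m + 1`, where `m` is at most
the index `n`. -/
theorem avoidName_congr {y z : Cantor} {n : ℕ} (h : ∀ i < 2 * n + 1, y i = z i) :
    avoidName e y n = avoidName e z n := by
  have h1 := Nat.unpair_left_le n
  have h2 := Nat.unpair_right_le n
  rw [avoidName, avoidName, layGuess_congr e fun i hi => h i (by omega),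
    cov_congr (fun _ _ => rfl) fun i hi => h i (by omega),
    pre_eq_iff.mpr fun i hi => h (n.unpair.1 + i) (by omega)]

variable {e}

theorem computable_layGuess (he : Computable₂ e) {α : Type} [Primcodable α] {y : α → ℕ → Bool}
    {n : α → ℕ} (hy : Computable₂ y) (hn : Computable n) :
    Computable fun a => layGuess e (y a) (n a) := by
  refine Computable.guess (D := fun a k s => cov (e k) (y a) s) ?_ hn
  refine Computable.cov (r := fun (q : α × ℕ × ℕ) => e q.2.1) (y := fun q => y q.1) ?_ ?_
    (Computable.snd.comp Computable.snd)
  · exact he.comp (Computable.fst.comp (Computable.snd.comp Computable.fst)) Computable.snd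
  · exact hy.comp (Computable.fst.comp Computable.fst) Computable.snd

theorem computable_avoidName (he : Computable₂ e) {α : Type} [Primcodable α] {y : α → ℕ → Bool}
    {n : α → ℕ} (hy : Computable₂ y) (hn : Computable n) :
    Computable fun a => avoidName e (y a) (n a) := by
  have h1 : Computable fun a => (n a).unpair.1 := Computable.fst.comp (Computable.unpair.comp hn)
  have h2 : Computable fun a => (n a).unpair.2 := Computable.snd.comp (Computable.unpair.comp hn)
  refine Computable.ite (Computable.cov ?_ hy h2) (Computable.succ.comp (Computable.encode.comp ?_))
    (Computable.const 0)
  · exact he.comp ((computable_layGuess he hy h1).comp Computable.fst) Computable.snd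
  · refine Computable.pre (y := fun a t => y a ((n a).unpair.1 + t)) ?_ (Computable.succ.comp h1)
    exact hy.comp Computable.fst (Computable.add (h1.comp Computable.fst) Computable.snd)

theorem mem_listed_avoidName {x y : Cantor} : x ∈ listed (avoidName e y) ↔
    ∃ m, y ∈ listed (e (layGuess e y m)) ∧ ∀ i < m + 1, x i = y (m + i) := by
  constructor
  · rintro ⟨n, w, hn, hx⟩
    rw [avoidName] at hn
    split_ifs at hn with h
    · obtain rfl := Encodable.encode_injective (Nat.succ_injective hn)
      exact ⟨n.unpair.1, mem_listed_iff.mpr ⟨_, h⟩, mem_cyl_pre.mp hx⟩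
  · rintro ⟨m, hm, hx⟩
    obtain ⟨s, hs⟩ := mem_listed_iff.mp hm
    refine ⟨Nat.pair m s, pre (fun t => y (m + t)) (m + 1), ?_, mem_cyl_pre.mpr hx⟩
    rw [avoidName]
    simp only [Nat.unpair_pair]
    rw [if_pos hs]

theorem linearUse_layGuess (he : Computable₂ e) :
    LinearUse fun p n => layGuess e (toCantor p) n where
  computable := computable_layGuess he (computable_toCantor_pad.comp
    (Computable.fst.comp Computable.fst) Computable.snd) Computable.snd
  use := ⟨1, one_pos, fun p q n h => layGuess_congr e fun i hi => toCantor_congr (h i (by omega))⟩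

theorem linearUse_pairB {F G : Baire → Baire} (hF : LinearUse F) (hG : LinearUse G) :
    LinearUse fun p => pairB (F p) (G p) where
  computable := by
    have hdiv : Computable fun q : List ℕ × ℕ => q.2 / 2 :=
      Primrec.nat_div.to_comp.comp Computable.snd (Computable.const 2)
    refine (Computable.ite (Computable.beq (Primrec.nat_mod.to_comp.comp Computable.snd
      (Computable.const 2)) (Computable.const 0)) (hF.computable.comp Computable.fst hdiv)
      (hG.computable.comp Computable.fst hdiv)).of_eq fun q => ?_
    simp [pairB]
  use := by
    obtain ⟨c, hc, hF⟩ := hF.use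
    obtain ⟨d, hd, hG⟩ := hG.use
    refine ⟨c + d, by omega, fun p q n h => ?_⟩
    have hle : n / 2 + 1 ≤ n + 1 := by omega
    simp only [pairB]
    rw [hF p q (n / 2) fun i hi => h i (hi.trans_le (Nat.mul_le_mul (by omega) hle)),
      hG p q (n / 2) fun i hi => h i (hi.trans_le (Nat.mul_le_mul (by omega) hle))]

theorem linearUse_id : LinearUse fun p => p where
  computable := computable_pad
  use := ⟨1, one_pos, fun p q n h => h n (by omega)⟩

theorem linearUse_avoidName (he : Computable₂ e) :
    LinearUse fun p => avoidName e (toCantor p) where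
  computable := computable_avoidName he (computable_toCantor_pad.comp
    (Computable.fst.comp Computable.fst) Computable.snd) Computable.snd
  use := ⟨2, two_pos, fun p q n h => avoidName_congr e fun i hi => toCantor_congr (h i (by omega))⟩

theorem exists_cyl_disjoint_avoidName {y : Cantor} (h : ∃ k, y ∉ listed (e k)) :
    ∃ u : List Bool, ∀ x ∈ cyl u, x ∉ listed (avoidName e y) := by
  obtain ⟨k, hk⟩ := h
  obtain ⟨n₀, hn₀⟩ := exists_guess_eventually (D := fun k s => cov (e k) y s)
    (fun m s t hst => cov_mono hst)
    ⟨k, fun s => Bool.eq_false_iff.mpr fun hs => hk (mem_listed_iff.mpr ⟨s, hs⟩)⟩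
  -- The diagonal word: its bit `m` differs from bit `m` of the `m`-th shift of `y`, which the
  -- `m`-th cylinder prescribes because its length is `m + 1`. From `n₀` on the guesses are correct
  -- and nothing is listed.
  refine ⟨pre (fun i => !y (i + i)) n₀, fun x hx hmem => ?_⟩
  obtain ⟨m, hm, hxm⟩ := mem_listed_avoidName.mp hmem
  by_cases hlt : m < n₀
  · have h1 := mem_cyl_pre.mp hx m hlt
    rw [hxm m (by omega)] at h1
    simp at h1
  · obtain ⟨s, hs⟩ := mem_listed_iff.mp hm
    have := hn₀ m (by omega) s
    simp only [layGuess] at hs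
    rw [this] at hs
    exact absurd hs (by simp)

end LayToHitting

/-- The answer `n` is translated back by recomputing the guess of stage `n` from the original input.
The proof uses only that the `n`-th shift lies in the set, not that `n` is least. -/
theorem lay_weihrauchLE_hittingTime {U : ℕ → Opens Cantor} (hU : IsUniversalMLTest U) :
    WeihrauchLE (lay U) hittingTimeClosed := by
  obtain ⟨e, he, hname⟩ := hU.1.1
  have hlist : ∀ i x, x ∈ listed (e i) ↔ x ∈ U i := fun i x => Set.ext_iff.mp (hname i) x
  refine ⟨_, _, (linearUse_layGuess he).computableB_eval,
    (linearUse_pairB linearUse_id (linearUse_avoidName he)).computableB, fun G hG p x hp hne => ?_⟩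
  have hpx : toCantor p = x.1 := by rw [isName_mlr.mp hp, toCantor_toNat]
  obtain ⟨k, hk⟩ := hne
  obtain ⟨u, hu⟩ := exists_cyl_disjoint_avoidName (e := e) (y := x.1)
    ⟨k, fun h => hk ((hlist _ _).mp h)⟩
  let A : Closeds Cantor := ⟨(listed (avoidName e x.1))ᶜ, (isOpen_listed _).isClosed_compl⟩
  have hA : 0 < coin A := (coin_cyl_pos u).trans_le (measure_mono fun z hz => hu z hz)
  have hin : IsName (pairB p (avoidName e (toCantor p))) ((x, ⟨A, hA⟩) : MLR × PosClosed) := by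
    refine ⟨p, _, rfl, hp, isName_posClosed.mpr fun z => ?_⟩
    rw [hpx]
    rfl
  have hdom : (hittingTimeClosed (x, ⟨A, hA⟩)).Nonempty := by
    classical
    obtain ⟨n, hn⟩ := x.2.exists_shift_mem_cyl u
    have hex : ∃ n, shift^[n] x.1 ∈ A := ⟨n, hu _ hn⟩
    exact ⟨Nat.find hex, Nat.find_spec hex, fun m hm => Nat.find_min' hex hm⟩
  obtain ⟨b, hb, n, hn, hbn⟩ := hG _ _ hin hdom
  refine ⟨fun _ => layGuess e x.1 n, ?_, layGuess e x.1 n, ?_, rfl⟩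
  · refine Part.mem_bind (Part.mem_some _) (Part.mem_bind hb ?_)
    rw [Part.mem_some_iff]
    funext _
    rw [pairB_left, hpx, pairB_one, isName_nat.mp hbn]
  · intro hmem
    -- If the guess of stage `n` were wrong, the cylinder around the `n`-th shift would have been
    -- removed from the set.
    refine hn.1 (mem_listed_avoidName.mpr ⟨n, (hlist _ _).mpr hmem, fun i _ => ?_⟩)
    rw [shift_iterate]

/-! ### The reduction of the hitting time to LAY -/

/-- Follow `w` by zeros: the resulting sequence is not random, so a search finds a prefix that
enters `U k`. -/
theorem exists_computable_extension {U : ℕ → Opens Cantor} (hU : IsUniversalMLTest U) :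
    ∃ X : ℕ → List Bool → List Bool, Computable₂ X ∧ ∀ k w,
      w <+: X k w ∧ w.length < (X k w).length ∧ cyl (X k w) ⊆ U k := by
  classical
  obtain ⟨e, he, hname⟩ := hU.1.1
  have hex : ∀ k w, ∃ s, cov (e k) (cat w fun _ => false) s = true := by
    intro k w
    rw [← mem_listed_iff, show listed (e k) = U k from hname k]
    have := not_isMLRandom_cat_zeros w
    rw [isMLRandom_iff hU, not_not] at this
    exact Set.mem_iInter.mp this k
  have hfind : Computable fun q : ℕ × List Bool => Nat.find (hex q.1 q.2) := by
    have hcov : Computable fun a : (ℕ × List Bool) × ℕ =>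
        cov (e a.1.1) (cat a.1.2 fun _ => false) a.2 := by
      refine Computable.cov (r := fun (a : (ℕ × List Bool) × ℕ) => e a.1.1)
        (y := fun a => cat a.1.2 fun _ => false) ?_ ?_ Computable.snd
      · exact he.comp ((Computable.fst.comp Computable.fst).comp Computable.fst) Computable.snd
      · exact Computable.catFalse ((Computable.snd.comp Computable.fst).comp Computable.fst)
          Computable.snd
    have hr := Partrec.rfind (p := fun (q : ℕ × List Bool) s =>
      (Part.some (cov (e q.1) (cat q.2 fun _ => false) s) : Part Bool)) hcov.partrec.to₂
    refine hr.of_eq_tot fun q => Nat.mem_rfind.mpr ⟨?_, fun {m} hm => ?_⟩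
    · exact Part.mem_some_iff.mpr (Nat.find_spec (hex q.1 q.2)).symm
    · exact Part.mem_some_iff.mpr (Bool.eq_false_iff.mpr (Nat.find_min (hex q.1 q.2) hm)).symm
  refine ⟨fun k w => pre (cat w fun _ => false) (w.length + (Nat.find (hex k w) + 1)), ?_, ?_⟩
  · refine Computable.pre (y := fun (q : ℕ × List Bool) => cat q.2 fun _ => false) ?_
      (Computable.add (Computable.list_length.comp Computable.snd) (Computable.succ.comp hfind))
    exact Computable.catFalse (Computable.snd.comp Computable.fst) Computable.snd
  · intro k w
    refine ⟨?_, by rw [length_pre]; omega, fun x hx => ?_⟩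
    · beta_reduce
      rw [pre_cat]; exact List.prefix_append _ _
    · rw [← show listed (e k) = U k from hname k, mem_listed_iff]
      refine ⟨Nat.find (hex k w), ?_⟩
      rw [cov_congr (fun _ _ => rfl) fun i hi => mem_cyl_pre.mp hx i (by omega)]
      exact Nat.find_spec (hex k w)

section HittingToLay

/-- At stage `s` it is known that the `m`-th iterate of `y` lies in the open set named by `r`. -/
def left (r : Baire) (y : Cantor) (m s : ℕ) : Bool := cov r (fun t => y (m + t)) s

/-- The guess of the hitting time at stage `n`. -/
def hitGuess (r : Baire) (y : Cantor) (n : ℕ) : ℕ := guess (left r y) n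

/-- At stage `t = ⟨k, s⟩` the guess of stage `k` is recognized to be wrong. -/
def alarm (r : Baire) (y : Cantor) (t : ℕ) : Bool :=
  left r y (hitGuess r y t.unpair.1) (t.unpair.2 + 1) &&
    !left r y (hitGuess r y t.unpair.1) t.unpair.2

/-- The state at stage `t`: a word, followed by the number of bits of `y` that are appended to it. At
every alarm the sequence written so far is extended into the layer in question, and then `y` is
copied from its beginning. -/
def state (X : ℕ → List Bool → List Bool) (r : Baire) (y : Cantor) (t : ℕ) : List Bool × ℕ :=
  Nat.rec ([], 0) (fun t z => if alarm r y t = true then (X t.unpair.1 (z.1 ++ pre y z.2), 0)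
    else (z.1, z.2 + 1)) t

/-- The word that is written at stage `t`. -/
def written (X : ℕ → List Bool → List Bool) (r : Baire) (y : Cantor) (t : ℕ) : List Bool :=
  (state X r y t).1 ++ pre y (state X r y t).2

variable (X : ℕ → List Bool → List Bool) (r : Baire) (y : Cantor)

theorem state_succ (t : ℕ) : state X r y (t + 1) = if alarm r y t = true then
    (X t.unpair.1 (written X r y t), 0) else ((state X r y t).1, (state X r y t).2 + 1) := rfl

variable {X r y}

theorem written_succ_of_alarm {t : ℕ} (h : alarm r y t = true) :
    written X r y (t + 1) = X t.unpair.1 (written X r y t) := by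
  rw [written, state_succ, if_pos h]
  simp [pre]

theorem written_succ_of_not_alarm {t : ℕ} (h : ¬ alarm r y t = true) :
    written X r y (t + 1) = written X r y t ++ [y (state X r y t).2] := by
  rw [written, state_succ, if_neg h, pre_succ, ← List.append_assoc]
  rfl

theorem written_prefix_succ (hX : ∀ k w, w <+: X k w) (t : ℕ) :
    written X r y t <+: written X r y (t + 1) := by
  by_cases h : alarm r y t = true
  · rw [written_succ_of_alarm h]; exact hX _ _
  · rw [written_succ_of_not_alarm h]; exact List.prefix_append _ _

theorem written_prefix (hX : ∀ k w, w <+: X k w) {s t : ℕ} (h : s ≤ t) :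
    written X r y s <+: written X r y t := by
  induction t, h using Nat.le_induction with
  | base => exact List.prefix_rfl
  | succ t _ ih => exact ih.trans (written_prefix_succ hX t)

theorem le_length_written (hX : ∀ k w, w.length < (X k w).length) (t : ℕ) :
    t ≤ (written X r y t).length := by
  induction t with
  | zero => exact Nat.zero_le _
  | succ t ih =>
    by_cases h : alarm r y t = true
    · rw [written_succ_of_alarm h]; exact ih.trans_lt (hX _ _)
    · rw [written_succ_of_not_alarm h]; simpa using ih

theorem state_snd_le (t : ℕ) : (state X r y t).2 ≤ t := by
  induction t with
  | zero => exact le_rfl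
  | succ t ih => rw [state_succ]; split_ifs <;> simp [ih]

theorem left_mono {m s t : ℕ} (hst : s ≤ t) (h : left r y m s = true) : left r y m t = true :=
  cov_mono hst h

theorem exists_left_iff {m : ℕ} : (∃ s, left r y m s = true) ↔ shift^[m] y ∈ listed r := by
  rw [mem_listed_iff, shift_iterate]; rfl

/-- An alarm marks the first stage at which a guess is refuted, so each `k` raises at most one. -/
theorem alarm_injOn : Set.InjOn (fun t : ℕ => t.unpair.1) {t | alarm r y t = true} := by
  intro t ht t' ht' h
  simp only [alarm, Set.mem_ofPred_eq, Bool.and_eq_true, Bool.not_eq_true'] at ht ht' h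
  rw [← h] at ht'
  have h2 : t.unpair.2 = t'.unpair.2 := by
    rcases lt_trichotomy t.unpair.2 t'.unpair.2 with hlt | heq | hlt
    · simp [left_mono hlt ht.1] at ht'
    · exact heq
    · simp [left_mono hlt ht'.1] at ht
  rw [← Nat.pair_unpair t, ← Nat.pair_unpair t', h, h2]

theorem exists_alarm {k : ℕ} (h : ∃ s, left r y (hitGuess r y k) s = true) :
    ∃ t, t.unpair.1 = k ∧ alarm r y t = true := by
  classical
  -- Nothing is refuted at stage 0, so the first refuting stage is a successor, as the form of
  -- `alarm` requires.
  obtain ⟨s, hs⟩ : ∃ s, Nat.find h = s + 1 := Nat.exists_eq_succ_of_ne_zero fun h0 => by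
    have := Nat.find_spec h
    rw [h0] at this
    exact absurd this (by simp [left, cov_zero])
  refine ⟨Nat.pair k s, by simp, ?_⟩
  have h1 := Nat.find_spec h
  have h2 := Nat.find_min h (m := s) (by omega)
  rw [hs] at h1
  simp [alarm, h1, h2]

/-- If `y` hits the set, then in the end a finite modification of `y` is written. -/
theorem exists_written_eq_pre (hX : ∀ k w, w <+: X k w)
    (h : ∃ m, shift^[m] y ∉ listed r) :
    ∃ v : List Bool, ∀ t, written X r y t = pre (cat v y) (written X r y t).length := by
  obtain ⟨m, hm⟩ := h
  obtain ⟨n₀, hn₀⟩ := exists_guess_eventually (D := left r y) (fun _ _ _ hst => left_mono hst)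
    ⟨m, fun s => Bool.eq_false_iff.mpr fun hs => hm (exists_left_iff.mp ⟨s, hs⟩)⟩
  -- Only the finitely many `k < n₀` can have a wrong guess, and each raises at most one alarm.
  have hfin : {t | alarm r y t = true}.Finite := by
    refine Set.Finite.of_finite_image ((Set.finite_lt_nat n₀).subset ?_) alarm_injOn
    rintro _ ⟨t, ht, rfl⟩
    by_contra hge
    simp only [Set.mem_ofPred_eq, not_lt] at hge
    have := hn₀ _ hge (t.unpair.2 + 1)
    simp only [alarm, hitGuess, this, Set.mem_ofPred_eq] at ht
    simp at ht
  obtain ⟨t₀, ht₀⟩ := hfin.bddAbove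
  -- After the last alarm the stored word is frozen and only the number of copied bits grows; this
  -- word is the `v` sought.
  have hstate : ∀ d, state X r y (t₀ + 1 + d) =
      ((state X r y (t₀ + 1)).1, (state X r y (t₀ + 1)).2 + d) := by
    intro d
    induction d with
    | zero => rfl
    | succ d ih =>
      rw [← add_assoc, state_succ, if_neg fun ha => by have := ht₀ ha; omega, ih, add_assoc]
  refine ⟨(state X r y (t₀ + 1)).1, fun t => ?_⟩
  have hlate : written X r y (t₀ + 1 + t) = pre (cat (state X r y (t₀ + 1)).1 y)
      ((state X r y (t₀ + 1)).1.length + ((state X r y (t₀ + 1)).2 + t)) := by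
    rw [pre_cat, written, hstate]
  have hp := written_prefix (r := r) (y := y) hX (show t ≤ t₀ + 1 + t by omega)
  rw [hlate] at hp
  rw [eq_pre_iff]
  refine ⟨rfl, fun i hi => ?_⟩
  rw [hp.getElem hi, getElem_pre]

/-! ### How much input the construction reads -/

theorem left_congr {r' : Baire} {y' : Cantor} {m s n : ℕ} (hn : m + s ≤ n)
    (hr : ∀ i < n, r i = r' i) (hy : ∀ i < n, y i = y' i) : left r y m s = left r' y' m s :=
  cov_congr (fun i hi => hr i (by omega)) fun i hi => hy _ (by omega)

theorem hitGuess_congr {r' : Baire} {y' : Cantor} {k n : ℕ} (hn : 2 * k ≤ n)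
    (hr : ∀ i < n, r i = r' i) (hy : ∀ i < n, y i = y' i) : hitGuess r y k = hitGuess r' y' k :=
  guess_congr fun _ _ _ _ => left_congr (by omega) hr hy

theorem alarm_congr {r' : Baire} {y' : Cantor} {t n : ℕ} (hn : 2 * t + 1 ≤ n)
    (hr : ∀ i < n, r i = r' i) (hy : ∀ i < n, y i = y' i) : alarm r y t = alarm r' y' t := by
  have h1 := Nat.unpair_add_le t
  have h2 : hitGuess r' y' t.unpair.1 ≤ t.unpair.1 := guess_le _ _
  rw [alarm, alarm, hitGuess_congr (by omega) hr hy, left_congr (by omega) hr hy,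
    left_congr (by omega) hr hy]

theorem state_congr {r' : Baire} {y' : Cantor} {t n : ℕ} (hn : 2 * t ≤ n)
    (hr : ∀ i < n, r i = r' i) (hy : ∀ i < n, y i = y' i) : state X r y t = state X r' y' t := by
  induction t with
  | zero => rfl
  | succ t ih =>
    have := state_snd_le (X := X) (r := r') (y := y') t
    rw [state_succ, state_succ, alarm_congr (by omega) hr hy, written, written, ih (by omega),
      pre_eq_iff.mpr fun i hi => hy i (by omega)]

theorem written_congr {r' : Baire} {y' : Cantor} {t n : ℕ} (hn : 2 * t ≤ n)
    (hr : ∀ i < n, r i = r' i) (hy : ∀ i < n, y i = y' i) :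
    written X r y t = written X r' y' t := by
  have := state_snd_le (X := X) (r := r') (y := y') t
  rw [written, written, state_congr hn hr hy, pre_eq_iff.mpr fun i hi => hy i (by omega)]

/-! ### Computability of the construction -/

section

variable {α : Type} [Primcodable α] {r : α → ℕ → ℕ} {y : α → ℕ → Bool} {n : α → ℕ}

theorem computable_left {m : α → ℕ} (hr : Computable₂ r) (hy : Computable₂ y)
    (hm : Computable m) (hn : Computable n) :
    Computable fun a => left (r a) (y a) (m a) (n a) :=
  Computable.cov hr (y := fun a t => y a (m a + t))
    (hy.comp Computable.fst (Computable.add (hm.comp Computable.fst) Computable.snd)) hn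

theorem computable_hitGuess (hr : Computable₂ r) (hy : Computable₂ y) (hn : Computable n) :
    Computable fun a => hitGuess (r a) (y a) (n a) :=
  Computable.guess (computable_left (r := fun q : α × ℕ × ℕ => r q.1) (y := fun q => y q.1)
    (hr.comp (Computable.fst.comp Computable.fst) Computable.snd)
    (hy.comp (Computable.fst.comp Computable.fst) Computable.snd)
    (Computable.fst.comp Computable.snd) (Computable.snd.comp Computable.snd)) hn

theorem computable_alarm (hr : Computable₂ r) (hy : Computable₂ y) (hn : Computable n) :
    Computable fun a => alarm (r a) (y a) (n a) := by
  have h1 : Computable fun a => (n a).unpair.1 := Computable.fst.comp (Computable.unpair.comp hn)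
  have h2 : Computable fun a => (n a).unpair.2 := Computable.snd.comp (Computable.unpair.comp hn)
  have hg := computable_hitGuess hr hy h1
  exact Computable.and (computable_left hr hy hg (Computable.succ.comp h2))
    (Computable.not (computable_left hr hy hg h2))

theorem computable_written (hX : Computable₂ X) (hr : Computable₂ r) (hy : Computable₂ y)
    (hn : Computable n) : Computable fun a => written X (r a) (y a) (n a) := by
  have hpre : ∀ {β : Type} [Primcodable β] {f : β → α} {z : β → List Bool × ℕ}, Computable f →
      Computable z → Computable fun b => (z b).1 ++ pre (y (f b)) (z b).2 := by
    intro β _ f z hf hz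
    exact Computable.list_append.comp (Computable.fst.comp hz) (Computable.pre
      (hy.comp (hf.comp Computable.fst) Computable.snd) (Computable.snd.comp hz))
  have hstate : Computable fun a => state X (r a) (y a) (n a) := by
    refine Computable.nat_rec (h := fun a (p : ℕ × List Bool × ℕ) =>
      if alarm (r a) (y a) p.1 = true then (X p.1.unpair.1 (p.2.1 ++ pre (y a) p.2.2), 0)
        else (p.2.1, p.2.2 + 1)) hn (Computable.const ([], 0)) ?_
    have hst : Computable fun q : α × ℕ × List Bool × ℕ => q.2.1 :=
      Computable.fst.comp Computable.snd
    have hz : Computable fun q : α × ℕ × List Bool × ℕ => q.2.2 :=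
      Computable.snd.comp Computable.snd
    refine Computable.ite ?_ (Computable.pair (hX.comp (Computable.fst.comp
      (Computable.unpair.comp hst)) (hpre Computable.fst hz)) (Computable.const 0))
      (Computable.pair (Computable.fst.comp hz) (Computable.succ.comp (Computable.snd.comp hz)))
    exact computable_alarm (r := fun q : α × ℕ × List Bool × ℕ => r q.1) (y := fun q => y q.1)
      (hr.comp (Computable.fst.comp Computable.fst) Computable.snd)
      (hy.comp (Computable.fst.comp Computable.fst) Computable.snd) hst
  exact hpre Computable.id hstate

end

theorem linearUse_hitGuess : LinearUse fun p n =>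
    hitGuess (fun i => p (2 * i + 1)) (toCantor fun i => p (2 * i)) n where
  computable := by
    refine computable_hitGuess (r := fun (q : List ℕ × ℕ) i => pad q.1 (2 * i + 1))
      (y := fun q => toCantor fun i => pad q.1 (2 * i)) ?_ ?_ Computable.snd
    · exact computable_pad.comp (Computable.fst.comp Computable.fst)
        (Computable.succ.comp (Computable.mul (Computable.const 2) Computable.snd))
    · exact computable_toCantor_pad.comp (Computable.fst.comp Computable.fst)
        (Computable.mul (Computable.const 2) Computable.snd)
  use := ⟨4, by omega, fun p q n h => hitGuess_congr le_rfl (fun i hi => h _ (by omega))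
    fun i hi => toCantor_congr (h _ (by omega))⟩

/-- Digit `t` is read off at stage `t + 1`. When `X` properly extends every word, at least `t + 1`
digits are present by then and the default `false` is never used. -/
theorem linearUse_written (hX : Computable₂ X) : LinearUse fun p t =>
    (cat (written X (fun i => p (2 * i + 1)) (toCantor fun i => p (2 * i)) (t + 1))
      (fun _ => false) t).toNat where
  computable := by
    have hnat : Computable Bool.toNat := (Primrec.dom_finite Bool.toNat).to_comp
    refine hnat.comp (Computable.catFalse ?_ Computable.snd)
    refine computable_written (r := fun (q : List ℕ × ℕ) i => pad q.1 (2 * i + 1))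
      (y := fun q => toCantor fun i => pad q.1 (2 * i)) hX ?_ ?_ (Computable.succ.comp Computable.snd)
    · exact computable_pad.comp (Computable.fst.comp Computable.fst)
        (Computable.succ.comp (Computable.mul (Computable.const 2) Computable.snd))
    · exact computable_toCantor_pad.comp (Computable.fst.comp Computable.fst)
        (Computable.mul (Computable.const 2) Computable.snd)
  -- Stage `t + 1` reads `2 * (t + 1)` entries of each component, and the pairing doubles this.
  use := ⟨4, by omega, fun p q t h => by
    rw [written_congr (n := 2 * (t + 1)) le_rfl (fun i hi => h _ (by omega))
      fun i hi => toCantor_congr (p := fun i => p (2 * i)) (q := fun i => q (2 * i)) (h _ (by omega))]⟩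

end HittingToLay

theorem hittingTime_weihrauchLE_lay {U : ℕ → Opens Cantor} (hU : IsUniversalMLTest U) :
    WeihrauchLE hittingTimeClosed (lay U) := by
  obtain ⟨X, hXc, hX⟩ := exists_computable_extension hU
  refine ⟨_, _, linearUse_hitGuess.computableB_eval, (linearUse_written hXc).computableB,
    fun G hG z x hz hne => ?_⟩
  obtain ⟨p, r, rfl, hp, hr⟩ := hz
  obtain ⟨⟨y, hy⟩, A, hA⟩ := x
  have hpy : toCantor p = y := by rw [isName_mlr.mp hp, toCantor_toNat]
  have hrA : ∀ x, x ∈ A ↔ x ∉ listed r := isName_posClosed.mp hr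
  obtain ⟨N, hN, -⟩ := hne
  obtain ⟨v, hv⟩ := exists_written_eq_pre (X := X) (r := r) (y := y) (fun k w => (hX k w).1)
    ⟨N, (hrA _).mp hN⟩
  have hF : (fun t => (cat (written X (fun i => pairB p r (2 * i + 1))
      (toCantor fun i => pairB p r (2 * i)) (t + 1)) (fun _ => false) t).toNat) =
      fun t => (cat v y t).toNat := by
    rw [pairB_left, pairB_right, hpy]
    funext t
    have hlt : t < (written X r y (t + 1)).length :=
      le_length_written (fun k w => (hX k w).2.1) (t + 1)
    rw [cat_of_lt _ _ hlt, ((eq_pre_iff.mp (hv (t + 1))).2 t hlt)]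
  have hrand : IsMLRandom (cat v y) := hy.cat v
  have hdom : (lay U ⟨cat v y, hrand⟩).Nonempty := by
    have := (isMLRandom_iff hU _).mp hrand
    rw [Set.mem_iInter, not_forall] at this
    exact this
  obtain ⟨b, hb, k, hk, hbk⟩ := hG _ ⟨cat v y, hrand⟩ (isName_mlr.mpr rfl) hdom
  -- A wrong guess at stage `k` would have raised an alarm, and the alarm forces the written
  -- sequence into `U k`.
  have hgood : ¬ ∃ s, left r y (hitGuess r y k) s = true := by
    intro hbad
    obtain ⟨t, rfl, ht⟩ := exists_alarm hbad
    refine hk ((hX t.unpair.1 (written X r y t)).2.2 ?_)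
    rw [← written_succ_of_alarm (X := X) ht]
    exact (hv (t + 1)).symm
  refine ⟨fun _ => hitGuess r y k, ?_, hitGuess r y k, ⟨?_, fun m hm => ?_⟩, rfl⟩
  · refine Part.mem_bind (Part.mem_some _) (Part.mem_bind (hF ▸ hb) ?_)
    rw [Part.mem_some_iff]
    funext _
    rw [pairB_left, pairB_left, pairB_right, hpy, pairB_one, isName_nat.mp hbk]
  · rw [exists_left_iff] at hgood
    exact (hrA _).mpr hgood
  -- A guess moves past `m` only after `m` has been refuted, so a correct guess is automatically
  -- minimal.
  · by_contra! hlt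
    exact (hrA _).mp hm (exists_left_iff.mp (exists_of_lt_guess hlt))

/-! ### The hitting time is not weakly layerwise computable -/

/-- At stage `s` it is known that the cylinder of `v` is contained in the open set named by `r`. -/
def covered (r : Baire) (v : List Bool) (s : ℕ) : Bool :=
  !bex (2 ^ s) fun z => !cov r (cat v (Nat.testBit z)) s

theorem exists_testBit_eq (y : Cantor) (s : ℕ) : ∃ z < 2 ^ s, ∀ i < s, Nat.testBit z i = y i :=
  ⟨Nat.ofBits fun i : Fin s => y i, Nat.ofBits_lt_two_pow _, fun i hi =>
    Nat.testBit_ofBits_lt (fun i : Fin s => y i) i hi⟩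

/-- Stage `s` inspects only `s` bits, so the `2 ^ s` bit patterns following `v` represent all points
of the cylinder. -/
theorem covered_iff {r : Baire} {v : List Bool} {s : ℕ} :
    covered r v s = true ↔ ∀ x ∈ cyl v, cov r x s = true := by
  have h1 : covered r v s = true ↔ ∀ z < 2 ^ s, cov r (cat v (Nat.testBit z)) s = true :=
    not_bex_not_iff
  rw [h1]
  constructor
  · intro h x hx
    obtain ⟨y, rfl⟩ := mem_cyl_iff_exists.mp hx
    obtain ⟨z, hz, hzy⟩ := exists_testBit_eq y s
    rw [← h z hz]
    exact cov_congr (fun _ _ => rfl) fun i hi => cat_congr v (fun j hj => (hzy j hj).symm) i (by omega)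
  · exact fun h z _ => h _ (cat_mem_cyl v _)

theorem covered_mono {r : Baire} {v : List Bool} {s t : ℕ} (hst : s ≤ t)
    (h : covered r v s = true) : covered r v t = true :=
  covered_iff.mpr fun x hx => cov_mono hst (covered_iff.mp h x hx)

theorem isOpen_cov (r : Baire) (s : ℕ) : IsOpen {x | cov r x s = true} := by
  have : {x | cov r x s = true} =
      {x : Cantor | pre x s ∈ (fun y : Cantor => pre y s) '' {x | cov r x s = true}} := by
    ext x
    constructor
    · exact fun h => ⟨x, h, rfl⟩
    · rintro ⟨y, hy, hyx⟩
      have h : cov r y s = true := hy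
      rwa [cov_congr (fun _ _ => rfl) (pre_eq_iff.mp hyx)] at h
  rw [this]
  exact isOpen_setOf_pre s _

/-- Compactness of the cylinder makes its inclusion in an enumerated open set recognizable at a
finite stage. -/
theorem exists_covered_iff {r : Baire} {v : List Bool} :
    (∃ s, covered r v s = true) ↔ cyl v ⊆ listed r := by
  constructor
  · rintro ⟨s, hs⟩ x hx
    exact mem_listed_iff.mpr ⟨s, covered_iff.mp hs x hx⟩
  · intro h
    obtain ⟨s, hs⟩ := (isClosed_cyl v).isCompact.elim_directed_cover
      (fun s => {x | cov r x s = true}) (isOpen_cov r)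
      (fun x hx => Set.mem_iUnion.mpr (mem_listed_iff.mp (h hx)))
      (directed_of_isDirected_le fun s t hst x hx => cov_mono hst hx)
    exact ⟨s, covered_iff.mpr hs⟩

/-! ### A relatively dense open set of small relative measure -/

/-- The `a`-th word that starts with `0`. -/
def zeroWord (a : ℕ) : List Bool := false :: (Encodable.decode a).getD []

/-- The `i`-th extension of `zeroWord a` by `a + 4` bits. -/
def cand (a i : ℕ) : List Bool :=
  pre (cat (zeroWord a) (Nat.testBit i)) ((zeroWord a).length + (a + 4))

theorem length_cand (a i : ℕ) : (cand a i).length = (zeroWord a).length + (a + 4) := length_pre _ _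

theorem cand_subset (a i : ℕ) : cyl (cand a i) ⊆ cyl (zeroWord a) := by
  intro x hx
  rw [cand, mem_cyl_pre] at hx
  rw [mem_cyl, ← pre_cat_length (zeroWord a) (Nat.testBit i), pre_cat_length, pre_eq_iff.mpr
    fun i hi => hx i (by omega), pre_cat_length]

theorem exists_mem_cand {x : Cantor} {a : ℕ} (hx : x ∈ cyl (zeroWord a)) : ∃ i, x ∈ cyl (cand a i) := by
  obtain ⟨y, rfl⟩ := mem_cyl_iff_exists.mp hx
  obtain ⟨i, -, hi⟩ := exists_testBit_eq y (a + 4)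
  exact ⟨i, mem_cyl_pre.mpr (cat_congr _ fun j hj => (hi j hj).symm)⟩

theorem computable_zeroWord : Computable zeroWord :=
  Computable.list_cons.comp (Computable.const false)
    (Computable.option_getD Computable.decode (Computable.const []))

theorem computable_cand : Computable₂ cand := by
  have hw : Computable fun q : ℕ × ℕ => zeroWord q.1 := computable_zeroWord.comp Computable.fst
  refine Computable.pre (y := fun (q : ℕ × ℕ) => cat (zeroWord q.1) (Nat.testBit q.2)) ?_
    (Computable.add (Computable.list_length.comp hw) (Computable.add Computable.fst (Computable.const 4)))
  exact Computable.cat (hw.comp Computable.fst)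
    (computable_testBit.comp ((Computable.snd.comp Computable.fst).comp Computable.fst)
      Computable.snd) Computable.snd

theorem computable_covered {r : Baire} (hr : Computable r) : Computable₂ (covered r) := by
  refine Computable.not (Computable.bex (computable_two_pow.comp Computable.snd)
    (Computable.not ?_))
  refine Computable.cov (r := fun (_ : (List Bool × ℕ) × ℕ) => r)
    (y := fun q => cat q.1.1 (Nat.testBit q.2)) (hr.comp Computable.snd) ?_
    (Computable.snd.comp Computable.fst)
  exact Computable.cat ((Computable.fst.comp Computable.fst).comp Computable.fst)
    (computable_testBit.comp ((Computable.snd.comp Computable.fst).comp Computable.fst)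
      Computable.snd) Computable.snd

/-- For every word `zeroWord a` this set contains the first of its candidate extensions that is not
contained in the open set named by `r`, and the candidates before that one. -/
def dense (r : Baire) : Set Cantor :=
  {x | ∃ a i, (∀ j < i, cyl (cand a j) ⊆ listed r) ∧ x ∈ cyl (cand a i)}

/-- A stagewise enumeration of `dense r`. -/
def denseStage (r : Baire) (x : Cantor) (s : ℕ) : Bool :=
  bex s fun a => bex s fun i => (!bex i fun j => !covered r (cand a j) s) &&
    (decide ((cand a i).length - s = 0) && decide (pre x (cand a i).length = cand a i))

theorem exists_denseStage_iff {r : Baire} {x : Cantor} :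
    (∃ s, denseStage r x s = true) ↔ x ∈ dense r := by
  have h : ∀ s, denseStage r x s = true ↔ ∃ a < s, ∃ i < s,
      (∀ j < i, covered r (cand a j) s = true) ∧ (cand a i).length ≤ s ∧ x ∈ cyl (cand a i) := by
    intro s
    simp only [denseStage, bex_iff, Bool.and_eq_true, not_bex_not_iff, decide_eq_true_eq, mem_cyl,
      Nat.sub_eq_zero_iff_le]
  simp only [h]
  constructor
  · rintro ⟨s, a, -, i, -, hc, -, hx⟩
    exact ⟨a, i, fun j hj => exists_covered_iff.mp ⟨s, hc j hj⟩, hx⟩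
  · rintro ⟨a, i, hc, hx⟩
    -- Finitely many inclusions have to be recognized, so one stage serves them all.
    have hbound : ∃ S, ∀ j < i, covered r (cand a j) S = true := by
      choose! f hf using fun j (hj : j < i) => exists_covered_iff.mpr (hc j hj)
      refine ⟨(Finset.range i).sup f, fun j hj => covered_mono ?_ (hf j hj)⟩
      exact Finset.le_sup (Finset.mem_range.mpr hj)
    obtain ⟨S, hS⟩ := hbound
    exact ⟨S + a + i + (cand a i).length + 1, a, by omega, i, by omega,
      fun j hj => covered_mono (by omega) (hS j hj), by omega, hx⟩

theorem exists_computable_name_dense {r : Baire} (hr : Computable r) :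
    ∃ p : Baire, Computable p ∧ listed p = dense r := by
  obtain ⟨p, hp, heq⟩ := exists_computable_listed (β := ℕ) (C := fun _ => denseStage r)
    (by
      have hai : Computable fun q : (((ℕ × List Bool) × ℕ) × ℕ) × ℕ => cand q.1.2 q.2 :=
        computable_cand.comp (Computable.snd.comp Computable.fst) Computable.snd
      have hs : Computable fun q : (((ℕ × List Bool) × ℕ) × ℕ) × ℕ => q.1.1.2 :=
        Computable.snd.comp (Computable.fst.comp Computable.fst)
      refine Computable.bex Computable.snd (Computable.bex (Computable.snd.comp Computable.fst)
        (Computable.and (Computable.not (Computable.bex Computable.snd (Computable.not ?_)))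
        (Computable.and (Computable.beq (Primrec.nat_sub.to_comp.comp
          (Computable.list_length.comp hai) hs) (Computable.const 0)) (Computable.beq ?_ hai))))
      · exact (computable_covered hr).comp (computable_cand.comp (Computable.snd.comp
          (Computable.fst.comp Computable.fst)) Computable.snd) (hs.comp Computable.fst)
      · refine Computable.pre (y := fun (q : (((ℕ × List Bool) × ℕ) × ℕ) × ℕ) =>
          cat q.1.1.1.2 fun _ => false) ?_ (Computable.list_length.comp hai)
        exact Computable.catFalse ((Computable.snd.comp (Computable.fst.comp (Computable.fst.comp
          Computable.fst))).comp Computable.fst) Computable.snd)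
    (by
      intro _ x y s h
      refine bex_congr fun a _ => bex_congr fun i _ => ?_
      by_cases hle : (cand a i).length ≤ s
      · rw [pre_eq_iff.mpr fun j hj => h j (hj.trans_le hle)]
      · simp [Nat.sub_eq_zero_iff_le, hle])
  refine ⟨p 0, hp.comp (Computable.const 0) Computable.id, ?_⟩
  rw [heq]
  ext x
  exact exists_denseStage_iff

theorem dense_subset (r : Baire) : dense r ⊆ cyl [false] := by
  rintro x ⟨a, i, -, hx⟩
  obtain ⟨y, rfl⟩ := mem_cyl_iff_exists.mp (cand_subset a i hx)
  rw [show zeroWord a = [false] ++ (Encodable.decode a).getD [] from rfl, cat_append]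
  exact cat_mem_cyl _ _

/-- For each `a`, all admitted candidates before the first uncovered one lie inside `listed r`, and
none after it is admitted. So outside `listed r` each `a` contributes at most one candidate
cylinder, and the contributions form a geometric series. -/
theorem coin_dense_diff_le (r : Baire) : coin (dense r \ listed r) ≤ 2⁻¹ ^ 4 := by
  classical
  have hsub : dense r \ listed r ⊆ ⋃ a, {x | x ∉ listed r ∧ ∃ i,
      (∀ j < i, cyl (cand a j) ⊆ listed r) ∧ x ∈ cyl (cand a i)} := by
    rintro x ⟨⟨a, h⟩, hx⟩
    exact Set.mem_iUnion.mpr ⟨a, hx, h⟩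
  have hle : ∀ a, coin {x | x ∉ listed r ∧ ∃ i,
      (∀ j < i, cyl (cand a j) ⊆ listed r) ∧ x ∈ cyl (cand a i)} ≤ 2⁻¹ ^ 5 * 2⁻¹ ^ a := by
    intro a
    by_cases hex : ∃ i, ¬ cyl (cand a i) ⊆ listed r
    · refine (measure_mono (t := cyl (cand a (Nat.find hex))) ?_).trans ?_
      · rintro x ⟨hx, i, hi, hxi⟩
        have : Nat.find hex = i := (Nat.find_eq_iff hex).mpr
          ⟨fun h => hx (h hxi), fun j hj => not_not.mpr (hi j hj)⟩
        rwa [this]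
      · rw [coin_cyl, length_cand, ← pow_add]
        -- `zeroWord a` has at least one bit, so a candidate has at least `a + 5`.
        exact pow_le_pow_of_le_one (by simp) (by simp) (by simp [zeroWord]; omega)
    · push Not at hex
      have : {x | x ∉ listed r ∧ ∃ i,
          (∀ j < i, cyl (cand a j) ⊆ listed r) ∧ x ∈ cyl (cand a i)} = ∅ := by
        ext x
        simp only [Set.mem_ofPred_eq, Set.mem_empty_iff_false, iff_false]
        rintro ⟨hx, i, -, hi⟩
        exact hx (hex i hi)
      rw [this]
      simp
  refine (measure_mono hsub).trans ((measure_iUnion_le _).trans ((ENNReal.tsum_le_tsum hle).trans ?_))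
  rw [ENNReal.tsum_mul_left, ENNReal.tsum_geometric, ENNReal.one_sub_inv_two, inv_inv, pow_succ,
    mul_assoc, ENNReal.inv_mul_cancel (by simp) (by simp), mul_one]

/-- The cylinder of `0` has measure 1/2, which exceeds 1/8 + 1/16. This is why layer 3 and the 4 in
`cand` are sufficient. -/
theorem exists_notMem_dense {r : Baire} (h : coin (listed r) ≤ 2⁻¹ ^ 3) :
    ∃ x ∈ cyl [false], x ∉ listed r ∧ x ∉ dense r := by
  by_contra! hno
  have hsub : cyl [false] ⊆ listed r ∪ (dense r \ listed r) := by
    intro x hx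
    by_cases hr : x ∈ listed r
    · exact Or.inl hr
    · exact Or.inr ⟨hno x hx hr, hr⟩
  have h1 : coin (cyl [false]) ≤ 2⁻¹ ^ 3 + 2⁻¹ ^ 4 :=
    (measure_mono hsub).trans ((measure_union_le _ _).trans (add_le_add h (coin_dense_diff_le r)))
  rw [coin_cyl] at h1
  have h2 : ((2⁻¹ : NNReal) : ℝ≥0∞) ^ 1 ≤ ((2⁻¹ : NNReal) : ℝ≥0∞) ^ 3 + ((2⁻¹ : NNReal) : ℝ≥0∞) ^ 4 := by
    rw [ENNReal.coe_inv two_ne_zero]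
    exact h1
  have h3 : (2⁻¹ : NNReal) ^ 1 ≤ (2⁻¹ : NNReal) ^ 3 + (2⁻¹ : NNReal) ^ 4 := by exact_mod_cast h2
  have h4 : (2⁻¹ : ℝ) ^ 1 ≤ (2⁻¹ : ℝ) ^ 3 + (2⁻¹ : ℝ) ^ 4 := by exact_mod_cast h3
  norm_num at h4

/-- Relative to the complement of the open set named by `r`, the set `dense r` is dense in the
sequences that start with `0`. -/
theorem exists_mem_dense_near {r : Baire} {x : Cantor} (hx : x ∈ cyl [false]) (hr : x ∉ listed r)
    (n : ℕ) : ∃ y ∈ dense r, y ∉ listed r ∧ ∀ i < n, y i = x i := by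
  classical
  obtain ⟨z, rfl⟩ := mem_cyl_iff_exists.mp hx
  have hw : zeroWord (Encodable.encode (pre z n)) = [false] ++ pre z n := by
    simp [zeroWord]
  have hmem : cat [false] z ∈ cyl (zeroWord (Encodable.encode (pre z n))) := by
    rw [hw, cat_mem_cyl_append]
    exact self_mem_cyl_pre z n
  obtain ⟨i, hi⟩ := exists_mem_cand hmem
  -- Some candidate contains the given point, which lies outside `listed r`. Hence a first uncovered
  -- candidate exists; it belongs to `dense r` and has a point outside `listed r`.
  have hex : ∃ i, ¬ cyl (cand (Encodable.encode (pre z n)) i) ⊆ listed r := ⟨i, fun h => hr (h hi)⟩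
  obtain ⟨y, hy, hyr⟩ := Set.not_subset.mp (Nat.find_spec hex)
  refine ⟨y, ⟨_, _, fun j hj => not_not.mp (Nat.find_min hex hj), hy⟩, hyr, fun j hj => ?_⟩
  have h := cand_subset _ _ hy
  rw [hw, ← pre_cat, mem_cyl_pre] at h
  exact h j (by simp; omega)

theorem not_weaklyLayerwiseComputable {U : ℕ → Opens Cantor} (hU : IsUniversalMLTest U) :
    ¬ WeaklyLayerwiseComputable U hittingTimeClosed := by
  classical
  obtain ⟨⟨⟨e, he, hname⟩, hcoin⟩, -⟩ := id hU
  have hrU : ∀ x, x ∈ listed (e 3) ↔ x ∈ U 3 := fun x => Set.ext_iff.mp (hname 3) x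
  have hrandom : ∀ x, x ∉ listed (e 3) → IsMLRandom x := fun x hx =>
    (isMLRandom_iff hU x).mpr fun h => hx ((hrU x).mpr (Set.mem_iInter.mp h 3))
  obtain ⟨a, ha, haeq⟩ := exists_computable_name_dense (he.comp (Computable.const 3) Computable.id)
  have hopen : IsOpen (dense (e 3)) := haeq ▸ isOpen_listed a
  have htrue : ∀ x ∈ cyl [true], x ∉ dense (e 3) := by
    intro x hx hd
    have h1 : [true] = [false] := (mem_cyl.mp hx).symm.trans (mem_cyl.mp (dense_subset _ hd))
    simp at h1
  let A : Closeds Cantor := ⟨(dense (e 3))ᶜ, hopen.isClosed_compl⟩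
  -- All of the cylinder of `1` survives in `A`. It also ensures that every random sequence hits
  -- `A`.
  have hApos : 0 < coin A := (coin_cyl_pos [true]).trans_le (measure_mono fun x hx => htrue x hx)
  have hdom : ∀ x : MLR, (hittingTimeClosed (x, ⟨A, hApos⟩)).Nonempty := by
    intro x
    obtain ⟨n, hn⟩ := x.2.exists_shift_mem_cyl [true]
    have hex : ∃ n, shift^[n] x.1 ∈ A := ⟨n, htrue _ hn⟩
    exact ⟨Nat.find hex, Nat.find_spec hex, fun m hm => Nat.find_min' hex hm⟩
  intro hweak
  -- The computability of `φ` is discarded: continuity of the realizer already gives the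
  -- contradiction.
  obtain ⟨g, ⟨F, ⟨φ, -, hφ⟩, hF⟩, hg⟩ := hweak ⟨A, hApos⟩
    ⟨a, ha, isName_posClosed.mpr fun x => by rw [haeq]; rfl⟩
  have key : ∀ x (hx : x ∉ listed (e 3)), ∃ q ∈ F (pairB (fun n => (x n).toNat) fun _ => 3),
      q 0 ∈ hittingTimeClosed (⟨x, hrandom x hx⟩, ⟨A, hApos⟩) := by
    intro x hx
    obtain ⟨n, hn, hng⟩ := hg ⟨x, hrandom x hx⟩ 3 (fun h => hx ((hrU x).mpr h)) (hdom _)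
    obtain ⟨q, hq, m, hm, hqm⟩ := hF (pairB (fun n => (x n).toNat) fun _ => 3)
      (⟨x, hrandom x hx⟩, 3) ⟨_, _, rfl, rfl, rfl⟩ ⟨n, hng⟩
    refine ⟨q, hq, ?_⟩
    rw [isName_nat.mp hqm, Part.mem_unique hm hng]
    exact hn
  have hlist : coin (listed (e 3)) ≤ 2⁻¹ ^ 3 := by
    rw [show listed (e 3) = U 3 from hname 3]
    exact hcoin 3
  obtain ⟨x, hx0, hxr, hxd⟩ := exists_notMem_dense hlist
  obtain ⟨q, hq, hqh⟩ := key x hxr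
  have hq0 : q 0 = 0 := Nat.le_zero.mp (hqh.2 hxd)
  -- The answer 0 at `x` is fixed after `s` input entries, so it is also given at any `y` outside
  -- layer 3 that agrees with `x` on `s` bits, including one in `dense`.
  obtain ⟨s, hs⟩ := (hφ _ _ hq).2 1
  obtain ⟨y, hyd, hyr, hyx⟩ := exists_mem_dense_near hx0 hxr s
  obtain ⟨q', hq', hqh'⟩ := key y hyr
  have hpre : pre (pairB (fun n => (y n).toNat) fun _ => 3) s =
      pre (pairB (fun n => (x n).toNat) fun _ => 3) s := by
    rw [pre_eq_iff]
    intro i hi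
    simp only [pairB, hyx (i / 2) (by omega)]
  obtain ⟨t, ht⟩ := (hφ _ _ hq).1 s
  obtain ⟨t', ht'⟩ := (hφ _ _ hq').1 s
  rw [hpre, ht] at ht'
  rw [ht, length_pre] at hs
  have htt : t = t' := by simpa [length_pre] using congrArg List.length ht'
  subst htt
  have hq0' : q' 0 = 0 := by rw [← pre_eq_iff.mp ht' 0 (by omega), hq0]
  rw [hq0'] at hqh'
  exact hqh'.1 hyd

end HittingTime

theorem theorem36 (U : ℕ → TopologicalSpace.Opens HittingTime.Cantor)
    (hU : HittingTime.IsUniversalMLTest U) :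
    HittingTime.WeihrauchEquiv HittingTime.hittingTimeClosed (HittingTime.lay U) ∧
      ¬ HittingTime.WeaklyLayerwiseComputable U HittingTime.hittingTimeClosed :=
  ⟨⟨HittingTime.hittingTime_weihrauchLE_lay hU, HittingTime.lay_weihrauchLE_hittingTime hU⟩,
    HittingTime.not_weaklyLayerwiseComputable hU⟩
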